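/- **Setting.** For a positive definite $\mathbf K_0\in\mathbb R^{m\times m}$ let $\mathrm{TN}(\mathbf 0,\mathbf K_0)$ be the distribution on $\mathbb R_+^m=[0,\infty)^m$ with density proportional to $\exp(-\tfrac12 x^\top\mathbf K_0x)$. Let $X^{(1)},\dots,X^{(n)}$ be i.i.d. with this law, and write $\mathbb E_0$ for expectation under it. Let $h_1,\dots,h_m:\mathbb R_+\to\mathbb R_+$ be in $\mathcal H_{1,1}$: each $h_j$ is absolutely continuous on bounded subintervals of $\mathbb R_+$, a.e. positive, $h_j$ and $h_j'$ are a.e. bounded by piecewise powers of $x$, and $\lim_{x\searrow0}h_j(x)=0$. Assume moreover $0\le h_j\le M$ and $0\le h_j'\le M'$ a.e. on $\mathbb R_+$ for all $j$. Index $\mathrm{vec}(\mathbf K)$, $\mathbf K\in\mathbb R^{m\times m}$, by pairs $(k,j)$ (row, column). Let $\boldsymbol\Gamma$ be the block-diagonal $m^2\times m^2$ matrix whose $j$-th block has $(k,\ell)$ entry $\frac1n\sum_{i}h_j(X^{(i)}_j)X^{(i)}_kX^{(i)}_\ell$, let $\boldsymbol g$ have $(k,j)$ entry $\frac1n\sum_i\big[h_j'(X_j^{(i)})X_k^{(i)}+\mathbf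 1_{\{k=j\}}h_j(X_j^{(i)})\big]$, and put $\boldsymbol\Gamma_{\gamma}=\boldsymbol\Gamma+(\delta-1)\,\mathrm{diag}(\boldsymbol\Gamma)$ with $$1<\delta<C(n,m)\equiv 2-\Big(1+4e\max\{6\log m/n,\sqrt{6\log m/n}\}\Big)^{-1}.$$ The estimator $\hat{\mathbf K}$ minimizes $\frac12\mathrm{vec}(\mathbf K)^\top\boldsymbol\Gamma_\gamma\mathrm{vec}(\mathbf K)-\boldsymbol g^\top\mathrm{vec}(\mathbf K)+\lambda\|\mathrm{vec}(\mathbf K)\|_1$ over all (not necessarily symmetric) $\mathbf K\in\mathbb R^{m\times m}$. Let $\boldsymbol\Gamma_0=\mathbb E_0\boldsymbol\Gamma$, let $S(\mathbf K)=\{(i,j):\kappa_{ij}\ne0\}$, $S_0=S(\mathbf K_0)$, let $d$ be the maximal number of nonzero entries in a column of $\mathbf K_0$, and, with $|||\cdot|||_\infty$ the maximal absolute row sum, $c_{\mathbf K_0}=|||\mathbf K_0|||_\infty$, $c_{\boldsymbol\Gamma_0}=|||(\boldsymbol\Gamma_{0,S_0S_0})^{-1}|||_\infty$, $c_X=2\max_j\big(2\sqrt{(\mathbf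 K_0^{-1})_{jj}}+\sqrt e\,\mathbb E_0X_j\big)$. Suppose $\boldsymbol\Gamma_{0,S_0S_0}$ is invertible and the irrepresentability condition $|||\boldsymbol\Gamma_{0,S_0^cS_0}(\boldsymbol\Gamma_{0,S_0S_0})^{-1}|||_\infty\le1-\alpha$ holds for some $\alpha\in(0,1]$. **Theorem.** There are absolute constants $C_1,C_2>0$ such that, in every such setting, if $\tau>3$, $$n>C_1\,\tau\log m\,\max\Big\{\frac{M^2c_{\boldsymbol\Gamma_0}^2c_X^4d^2}{\alpha^2},\frac{Mc_{\boldsymbol\Gamma_0}c_X^2d}{\alpha}\Big\},$$ $$\lambda>C_2\,\frac{2-\alpha}{\alpha}\,(Mc_{\mathbf K_0}c_X^2+M'c_X+M)\Big(\sqrt{\tfrac{\tau\log m}{n}}+\tfrac{\tau\log m}{n}\Big),$$ then the following hold on an event of probability at least $1-m^{3-\tau}$: (a) the minimizer $\hat{\mathbf K}$ exists and is unique, $S(\hat{\mathbf K})\subseteq S_0$, and $$\max_{j,k}|\hat\kappa_{jk}-\kappa_{0,jk}|\le\frac{2c_{\boldsymbol\Gamma_0}}{2-\alpha}\lambda,\quad\|\hat{\mathbf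 K}-\mathbf K_0\|_F\le\frac{2c_{\boldsymbol\Gamma_0}}{2-\alpha}\lambda\sqrt{|S_0|},\quad|||\hat{\mathbf K}-\mathbf K_0|||_2\le\frac{2c_{\boldsymbol\Gamma_0}}{2-\alpha}\lambda\min(\sqrt{|S_0|},d);$$ (b) if moreover $\min_{(j,k)\in S_0}|\kappa_{0,jk}|>\frac{2c_{\boldsymbol\Gamma_0}}{2-\alpha}\lambda$, then $S(\hat{\mathbf K})=S_0$ and $\mathrm{sign}(\hat\kappa_{jk})=\mathrm{sign}(\kappa_{0,jk})$ for all $(j,k)\in S_0$. -/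

import Mathlib

open MeasureTheory ProbabilityTheory Filter Topology
open scoped Matrix

namespace GSM

noncomputable section

/-! ### The truncated normal distribution -/

/-- The unnormalized truncated normal measure on `ℝ₊^m`: Lebesgue density
`exp (-(x - μ)ᵀ K (x - μ) / 2)` on the orthant `{x | ∀ j, 0 ≤ x j}`. -/
def truncNormalWeight {m : ℕ} (μ : Fin m → ℝ) (K : Matrix (Fin m) (Fin m) ℝ) :
    Measure (Fin m → ℝ) :=
  (volume.restrict {x : Fin m → ℝ | ∀ j, 0 ≤ x j}).withDensity
    (fun x => ENNReal.ofReal (Real.exp (-(1 / 2) * ((x - μ) ⬝ᵥ (K *ᵥ (x - μ))))))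

/-- The truncated normal distribution `TN(μ, K)` (for positive definite `K`), with mean parameter
`μ` and inverse covariance parameter `K`. -/
def truncNormal {m : ℕ} (μ : Fin m → ℝ) (K : Matrix (Fin m) (Fin m) ℝ) :
    Measure (Fin m → ℝ) :=
  (truncNormalWeight μ K Set.univ)⁻¹ • truncNormalWeight μ K

/-! ### The class `𝓗_{a,b}` of weight functions -/

/-- `f` is bounded by piecewise powers of `x` almost everywhere on `(0, ∞)`: the half-line is
covered by finitely many intervals `I k`, with `|f x| ≤ c k * x ^ p k` a.e. on `I k`. -/
def BoundedByPiecewisePowers (f : ℝ → ℝ) : Prop :=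
  ∃ (N : ℕ) (I : Fin N → Set ℝ) (c p : Fin N → ℝ),
    (∀ k, (I k).OrdConnected) ∧ Set.Ioi (0 : ℝ) ⊆ ⋃ k, I k ∧
    ∀ᵐ x ∂(volume.restrict (Set.Ioi (0 : ℝ))), ∀ k, x ∈ I k → |f x| ≤ c k * x ^ p k

/-- The class `𝓗_{a,b}` for `b > 0`. Only the values of `h j` on `[0, ∞)` matter. -/
structure MemH {m : ℕ} (a b : ℝ) (h : Fin m → ℝ → ℝ) : Prop where
  nonneg : ∀ j x, 0 ≤ x → 0 ≤ h j x
  absCont : ∀ j s t, 0 ≤ s → s ≤ t → AbsolutelyContinuousOnInterval (h j) s t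
  pos : ∀ j, ∀ᵐ x ∂(volume.restrict (Set.Ioi (0 : ℝ))), 0 < h j x
  growth : ∀ j, BoundedByPiecewisePowers (h j)
  growth_deriv : ∀ j, BoundedByPiecewisePowers (deriv (h j))
  lim_zero : ∀ j, Tendsto (fun x => h j x / x ^ max (1 - a) (1 - b)) (𝓝[>] 0) (𝓝 0)

/-! ### The quadratic score matching loss of the centered truncated Gaussian model

The parameter is an `m × m` matrix `K` (not required to be symmetric). Its vectorization is
indexed by pairs `(k, j)` = (row, column) of `K`; the `j`-th diagonal block of the quadratic form
collects the pairs with second component `j`. -/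

/-- Contribution of one observation `x` to `Γ`: the `(k, l)` entry of the `j`-th diagonal block is
`h_j(x_j) x_k x_l`, and entries outside the diagonal blocks vanish. -/
def gammaTerm {m : ℕ} (h : Fin m → ℝ → ℝ) (x : Fin m → ℝ) :
    Matrix (Fin m × Fin m) (Fin m × Fin m) ℝ :=
  fun p q => if p.2 = q.2 then h p.2 (x p.2) * x p.1 * x q.1 else 0

/-- Contribution of one observation `x` to `g`: the entry at row `k`, column `j` is
`h_j'(x_j) x_k + 1{k = j} h_j(x_j)`. -/
def gTerm {m : ℕ} (h : Fin m → ℝ → ℝ) (x : Fin m → ℝ) : Fin m × Fin m → ℝ :=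
  fun p => deriv (h p.2) (x p.2) * x p.1 + if p.1 = p.2 then h p.2 (x p.2) else 0

/-- `Γ(x)` for the `n × m` data matrix `x`. -/
def sampleGamma {n m : ℕ} (h : Fin m → ℝ → ℝ) (x : Fin n → Fin m → ℝ) :
    Matrix (Fin m × Fin m) (Fin m × Fin m) ℝ :=
  fun p q => (1 / (n : ℝ)) * ∑ i, gammaTerm h (x i) p q

/-- `g(x)` for the `n × m` data matrix `x`. -/
def sampleG {n m : ℕ} (h : Fin m → ℝ → ℝ) (x : Fin n → Fin m → ℝ) : Fin m × Fin m → ℝ :=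
  fun p => (1 / (n : ℝ)) * ∑ i, gTerm h (x i) p

/-- The population matrix `Γ₀ = 𝔼₀ Γ(x)` for observations with law `P₀`. -/
def popGamma {m : ℕ} (h : Fin m → ℝ → ℝ) (P₀ : Measure (Fin m → ℝ)) :
    Matrix (Fin m × Fin m) (Fin m × Fin m) ℝ :=
  fun p q => ∫ x, gammaTerm h x p q ∂P₀

/-- `Γ_γ = Γ + diag(γ)` with the amplifier `γ = (δ - 1) diag(Γ)` given by the multiplier `δ`. -/
def amplifiedGamma {n m : ℕ} (h : Fin m → ℝ → ℝ) (δ : ℝ) (x : Fin n → Fin m → ℝ) :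
    Matrix (Fin m × Fin m) (Fin m × Fin m) ℝ :=
  sampleGamma h x + Matrix.diagonal (fun p => (δ - 1) * sampleGamma h x p p)

/-- The vectorization of a matrix. -/
def vec {m : ℕ} (K : Matrix (Fin m) (Fin m) ℝ) : Fin m × Fin m → ℝ := fun p => K p.1 p.2

/-- The `ℓ₁`-regularized, amplified generalized score matching loss
`vec(K)ᵀ Γ_γ(x) vec(K) / 2 - g(x)ᵀ vec(K) + lam ‖K‖₁`. -/
def regLoss {n m : ℕ} (h : Fin m → ℝ → ℝ) (δ lam : ℝ) (x : Fin n → Fin m → ℝ)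
    (K : Matrix (Fin m) (Fin m) ℝ) : ℝ :=
  (1 / 2) * (vec K ⬝ᵥ (amplifiedGamma h δ x *ᵥ vec K)) - sampleG h x ⬝ᵥ vec K
    + lam * ∑ p, |vec K p|

/-- `Khat` minimizes the regularized loss over all `m × m` matrices. -/
def IsEstimator {n m : ℕ} (h : Fin m → ℝ → ℝ) (δ lam : ℝ) (x : Fin n → Fin m → ℝ)
    (Khat : Matrix (Fin m) (Fin m) ℝ) : Prop :=
  ∀ K, regLoss h δ lam x Khat ≤ regLoss h δ lam x K

/-! ### Norms, supports and constants -/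

/-- The support `S(K) = {(i, j) | K_{ij} ≠ 0}`. -/
def supp {m : ℕ} (K : Matrix (Fin m) (Fin m) ℝ) : Finset (Fin m × Fin m) :=
  {p | K p.1 p.2 ≠ 0}

/-- The maximal number of nonzero entries in a column. -/
def colDegree {m : ℕ} (K : Matrix (Fin m) (Fin m) ℝ) : ℕ :=
  Finset.univ.sup fun j => (Finset.univ.filter fun i => K i j ≠ 0).card

/-- The entrywise maximum norm. -/
def maxNorm {m : ℕ} (A : Matrix (Fin m) (Fin m) ℝ) : ℝ := ⨆ p : Fin m × Fin m, |A p.1 p.2|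

/-- The `ℓ_∞`-`ℓ_∞` operator norm, i.e. the maximal absolute row sum. -/
def rowSumNorm {ι κ : Type*} [Fintype κ] (A : Matrix ι κ ℝ) : ℝ := ⨆ i, ∑ j, |A i j|

/-- The Frobenius norm. -/
def frobNorm {m : ℕ} (A : Matrix (Fin m) (Fin m) ℝ) : ℝ := √(∑ i, ∑ j, A i j ^ 2)

/-- The spectral norm, i.e. the `ℓ₂`-`ℓ₂` operator norm. -/
def specNorm {m : ℕ} (A : Matrix (Fin m) (Fin m) ℝ) : ℝ :=
  ‖Matrix.toEuclideanCLM (n := Fin m) (𝕜 := ℝ) A‖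

/-- The submatrix with rows in `A` and columns in `B`. -/
def block {ι : Type*} (G : Matrix ι ι ℝ) (A B : Finset ι) : Matrix A B ℝ :=
  G.submatrix (fun i => (i : ι)) (fun j => (j : ι))

/-- `c_{Γ₀}`, the `ℓ_∞` operator norm of `(Γ_{0,SS})⁻¹`. -/
def cGamma {ι : Type*} [Fintype ι] [DecidableEq ι] (G : Matrix ι ι ℝ) (S : Finset ι) : ℝ :=
  rowSumNorm (block G S S)⁻¹

/-- The irrepresentability condition with incoherence parameter `α` and edge set `S`. -/
def Irrepresentable {ι : Type*} [Fintype ι] [DecidableEq ι] (G : Matrix ι ι ℝ) (S : Finset ι)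
    (α : ℝ) : Prop :=
  rowSumNorm (block G Sᶜ S * (block G S S)⁻¹) ≤ 1 - α

/-- `c_X = 2 max_j (2 √((K⁻¹)_{jj}) + √e 𝔼 X_j)` for `X ∼ TN(0, K)`. -/
def cX {m : ℕ} (K : Matrix (Fin m) (Fin m) ℝ) : ℝ :=
  2 * ⨆ j, (2 * √(K⁻¹ j j) + √(Real.exp 1) * ∫ x, x j ∂(truncNormal 0 K))

/-- The upper bound `C(n, m) = 2 - (1 + 4 e max{6 log m / n, √(6 log m / n)})⁻¹` for the
multiplier. -/
def multiplierBound (n m : ℕ) : ℝ :=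
  2 - (1 + 4 * Real.exp 1 *
    max (6 * Real.log m / n) (√(6 * Real.log m / n)))⁻¹

end

end GSM

namespace GSM

/-! ### The Prékopa–Leindler inequality -/

/-! The unregularized population loss is stationary at K₀: integration by parts along each
coordinate line, with h_j(0) = 0 removing the boundary term, gives Γ₀ vec(K₀) = g₀
(`BoundedWeights.popGamma_mulVec`). The estimator solves a lasso problem whose data (Γ_γ, g) are
close to (Γ₀, g₀), so a primal-dual witness argument applies. Minimize over matrices supported on
S₀; invertibility of the S₀ block bounds the error, and irrepresentability keeps the gradient off S₀
within [-λ, λ], so this restricted minimizer is a global one (`primalDualWitness`,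
`estimator_of_bounds`). Since δ > 1, Γ_γ is positive definite as soon as all observations and
weights are positive, which yields existence and uniqueness whatever n ≥ 1 is.

It suffices that Γ_γ and g be entrywise within ε and ε' of Γ₀ and g₀, where c_Γ ε d ≤ α/8 and ε' + ε
c_K ≤ λα/8. Because Γ is block diagonal, each coordinate sees a single column of K₀, hence d and c_K
rather than |S₀| and the full ℓ₁ norm. The entries of Γ and g are means of i.i.d. sub-exponential
variables of scales M c_X² and M' c_X + M; Bernstein's inequality and a union bound over m⁴ + m²
entries control them (`exists_event`). The upper bound on δ makes the amplifier an error of the same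
order.

The sub-exponential scales must not depend on the dimension. They come from log 𝔼 exp(aX_j) ≤ a 𝔼X_j
+ a² (K₀⁻¹)_jj. The midpoint Prékopa–Leindler inequality, applied to the Gaussian density on the
convex orthant, bounds 𝔼 exp(aX_j) · 𝔼 exp(-aX_j) by exp(a² (K₀⁻¹)_jj), and Jensen's inequality
bounds the second factor below. -/

theorem volume_add_volume_le_of_midpoint_mem {A B C : Set ℝ} (hA : MeasurableSet A)
    (hB : MeasurableSet B) (hA0 : A.Nonempty) (hB0 : B.Nonempty)
    (hC : ∀ x ∈ A, ∀ y ∈ B, (x + y) / 2 ∈ C) : volume A + volume B ≤ 2 * volume C := by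
  obtain ⟨a, ha⟩ := hA0
  obtain ⟨b, hb⟩ := hB0
  have key : ∀ K₁ ⊆ A, IsCompact K₁ → K₁.Nonempty → ∀ K₂ ⊆ B, IsCompact K₂ → K₂.Nonempty →
      volume K₁ + volume K₂ ≤ 2 * volume C := by
    intro K₁ h₁ c₁ n₁ K₂ h₂ c₂ n₂
    obtain ⟨x₀, hx₀, hmax⟩ := c₁.exists_isMaxOn n₁ continuousOn_id
    obtain ⟨y₀, hy₀, hmin⟩ := c₂.exists_isMinOn n₂ continuousOn_id
    -- With x₀ = max K₁ and y₀ = min K₂, the translates K₁ + y₀ and K₂ + x₀ lie in 2C on either side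
    -- of x₀ + y₀ and meet at most there, so their lengths add.
    set L : Set ℝ := (fun z => z + (-y₀)) ⁻¹' K₁ with hL
    set R : Set ℝ := (fun z => z + (-x₀)) ⁻¹' K₂ with hR
    have vL : volume L = volume K₁ := measure_preimage_add_right _ _ _
    have vR : volume R = volume K₂ := measure_preimage_add_right _ _ _
    have hRm : MeasurableSet R := (measurable_id.add_const _) c₂.measurableSet
    have hd : AEDisjoint volume L R := by
      refine measure_mono_null (t := {x₀ + y₀}) ?_ (by simp)
      rintro z ⟨hz₁, hz₂⟩
      have e₁ : z + -y₀ ≤ x₀ := hmax hz₁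
      have e₂ : y₀ ≤ z + -x₀ := hmin hz₂
      simp only [Set.mem_singleton_iff]
      linarith
    have hsub : L ∪ R ⊆ (fun z => (1 / 2 : ℝ) * z) ⁻¹' C := by
      rintro z (hz | hz)
      · have := hC _ (h₁ hz) _ (h₂ hy₀)
        simp only [Set.mem_preimage]
        convert this using 1
        ring
      · have := hC _ (h₁ hx₀) _ (h₂ hz)
        simp only [Set.mem_preimage]
        convert this using 1
        ring
    calc volume K₁ + volume K₂ = volume (L ∪ R) := by
          rw [measure_union₀ hRm.nullMeasurableSet hd, vL, vR]
      _ ≤ volume ((fun z => (1 / 2 : ℝ) * z) ⁻¹' C) := measure_mono hsub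
      _ = 2 * volume C := by
          rw [Real.volume_preimage_mul_left (by norm_num)]
          norm_num
  have inner : ∀ D : Set ℝ, MeasurableSet D →
      volume D = ⨆ K : {K : Set ℝ // K ⊆ D ∧ IsCompact K}, volume K.1 := by
    intro D hD
    rw [hD.measure_eq_iSup_isCompact, iSup_subtype]
    simp only [iSup_and]
  have : ∀ D : Set ℝ, Nonempty {K : Set ℝ // K ⊆ D ∧ IsCompact K} := fun D =>
    ⟨⟨∅, Set.empty_subset _, isCompact_empty⟩⟩
  rw [inner A hA, inner B hB]
  refine ENNReal.iSup_add_iSup_le fun ⟨K₁, h₁, c₁⟩ ⟨K₂, h₂, c₂⟩ => ?_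
  exact le_trans (add_le_add (measure_mono (Set.subset_insert a K₁))
    (measure_mono (Set.subset_insert b K₂)))
    (key _ (Set.insert_subset ha h₁) (c₁.insert a) (Set.insert_nonempty _ _) _
      (Set.insert_subset hb h₂) (c₂.insert b) (Set.insert_nonempty _ _))

/-- Layer cake formula for functions with values in `[0, ∞]`. -/
theorem lintegral_eq_lintegral_volume_lt {f : ℝ → ENNReal} (hf : Measurable f) :
    ∫⁻ x, f x = ∫⁻ t in Set.Ioi (0 : ℝ), volume {x | ENNReal.ofReal t < f x} := by
  have hS : MeasurableSet {p : ℝ × ℝ | ENNReal.ofReal p.2 < f p.1} :=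
    measurableSet_lt (ENNReal.measurable_ofReal.comp measurable_snd) (hf.comp measurable_fst)
  have h1 : ∀ x, f x = ∫⁻ t in Set.Ioi (0 : ℝ),
      Set.indicator {p : ℝ × ℝ | ENNReal.ofReal p.2 < f p.1} 1 (x, t) := by
    intro x
    have : (fun t => Set.indicator {p : ℝ × ℝ | ENNReal.ofReal p.2 < f p.1} (1 : ℝ × ℝ → ENNReal) (x, t))
        = Set.indicator {t : ℝ | ENNReal.ofReal t < f x} 1 := by
      ext t; simp [Set.indicator]
    rw [this, lintegral_indicator_one (measurableSet_lt ENNReal.measurable_ofReal measurable_const),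
      Measure.restrict_apply (measurableSet_lt ENNReal.measurable_ofReal measurable_const)]
    by_cases hx : f x = ⊤
    · have : {t : ℝ | ENNReal.ofReal t < f x} ∩ Set.Ioi 0 = Set.Ioi 0 := by
        ext t; simp [hx]
      rw [this, hx, Real.volume_Ioi]
    · have : {t : ℝ | ENNReal.ofReal t < f x} ∩ Set.Ioi 0 = Set.Ioo 0 (f x).toReal := by
        ext t
        simp only [Set.mem_inter_iff, Set.mem_ofPred_eq, Set.mem_Ioi, Set.mem_Ioo]
        constructor
        · rintro ⟨h, h0⟩
          exact ⟨h0, (ENNReal.ofReal_lt_iff_lt_toReal h0.le hx).1 h⟩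
        · rintro ⟨h0, h⟩
          exact ⟨(ENNReal.ofReal_lt_iff_lt_toReal h0.le hx).2 h, h0⟩
      rw [this, Real.volume_Ioo, sub_zero, ENNReal.ofReal_toReal hx]
  calc ∫⁻ x, f x = ∫⁻ x, ∫⁻ t in Set.Ioi (0 : ℝ),
      Set.indicator {p : ℝ × ℝ | ENNReal.ofReal p.2 < f p.1} 1 (x, t) := by
        exact lintegral_congr h1
    _ = ∫⁻ t in Set.Ioi (0 : ℝ), ∫⁻ x,
      Set.indicator {p : ℝ × ℝ | ENNReal.ofReal p.2 < f p.1} 1 (x, t) := by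
        apply lintegral_lintegral_swap
        exact (measurable_one.indicator hS).aemeasurable
    _ = _ := by
        refine lintegral_congr fun t => ?_
        have : (fun x => Set.indicator {p : ℝ × ℝ | ENNReal.ofReal p.2 < f p.1} (1 : ℝ × ℝ → ENNReal) (x, t))
          = Set.indicator {x : ℝ | ENNReal.ofReal t < f x} 1 := by
          ext t; simp [Set.indicator]
        rw [this, lintegral_indicator_one (measurableSet_lt measurable_const hf)]

theorem mul_le_sq_of_midpoint_add_le {a b c : ENNReal} (h : a + b ≤ 2 * c) : a * b ≤ c ^ 2 := by
  by_cases hc : c = ⊤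
  · simp [hc]
  have h2 : 2 * c ≠ ⊤ := ENNReal.mul_ne_top (by simp) hc
  have ha : a ≠ ⊤ := ne_top_of_le_ne_top h2 (le_self_add.trans h)
  have hb : b ≠ ⊤ := ne_top_of_le_ne_top h2 (le_add_self.trans h)
  lift a to NNReal using ha
  lift b to NNReal using hb
  lift c to NNReal using hc
  norm_cast at h ⊢
  have h' : (a : ℝ) + b ≤ 2 * c := by exact_mod_cast h
  have : (a : ℝ) * b ≤ c ^ 2 := by
    nlinarith [sq_nonneg ((a : ℝ) - b), a.2, b.2, c.2, mul_self_le_mul_self (add_nonneg a.2 b.2) h']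
  exact_mod_cast this

/-- With both suprema equal to 1, for 0 < t < 1 the level sets {f > t} and {g > t} are nonempty and
their midpoints lie in {h > t}. The one-dimensional set inequality then integrates over t; for t ≥ 1
the left side vanishes. -/
theorem lintegral_add_lintegral_le_of_midpoint {f g h : ℝ → ENNReal} (hf : Measurable f)
    (hg : Measurable g) (hh : Measurable h) (hfs : ⨆ x, f x = 1) (hgs : ⨆ x, g x = 1)
    (H : ∀ x y, f x * g y ≤ h ((x + y) / 2) ^ 2) :
    (∫⁻ x, f x) + (∫⁻ x, g x) ≤ 2 * ∫⁻ x, h x := by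
  rw [lintegral_eq_lintegral_volume_lt hf, lintegral_eq_lintegral_volume_lt hg,
    lintegral_eq_lintegral_volume_lt hh]
  have hmeas : ∀ f : ℝ → ENNReal,
      Measurable fun t : ℝ => volume {x | ENNReal.ofReal t < f x} := by
    intro f
    refine Antitone.measurable fun s t hst => measure_mono fun x hx => ?_
    exact (ENNReal.ofReal_le_ofReal hst).trans_lt hx
  rw [← lintegral_add_left (hmeas f), ← lintegral_const_mul _ (hmeas h)]
  refine setLIntegral_mono ((hmeas h).const_mul _) fun t ht => ?_
  by_cases h1 : 1 ≤ t
  · have e : ∀ f : ℝ → ENNReal, ⨆ x, f x = 1 → {x | ENNReal.ofReal t < f x} = ∅ := by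
      intro f hf
      ext x
      simp only [Set.mem_ofPred_eq, Set.mem_empty_iff_false, iff_false, not_lt]
      exact (le_iSup f x).trans (hf.le.trans (by simpa using h1))
    rw [e f hfs, e g hgs]
    simp
  · have ht1 : ENNReal.ofReal t < 1 := by simpa using h1
    obtain ⟨x, hx⟩ := lt_iSup_iff.1 (hfs ▸ ht1)
    obtain ⟨y, hy⟩ := lt_iSup_iff.1 (hgs ▸ ht1)
    refine volume_add_volume_le_of_midpoint_mem (measurableSet_lt measurable_const hf)
      (measurableSet_lt measurable_const hg) ⟨x, hx⟩ ⟨y, hy⟩ fun x hx y hy => ?_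
    simp only [Set.mem_ofPred_eq] at hx hy ⊢
    have := (ENNReal.mul_lt_mul hx hy).trans_le (H x y)
    rw [← sq] at this
    exact lt_of_pow_lt_pow_left' 2 this

/-- Dividing f, g, h by sup f, sup g and the geometric mean of these suprema preserves the
hypothesis and reduces to the additive inequality, from which AM-GM gives the product form. -/
theorem prekopaLeindler_real_of_bdd {f g h : ℝ → ENNReal} (hf : Measurable f)
    (hg : Measurable g) (hh : Measurable h) (hfs : ⨆ x, f x ≠ ⊤) (hgs : ⨆ x, g x ≠ ⊤)
    (H : ∀ x y, f x * g y ≤ h ((x + y) / 2) ^ 2) :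
    (∫⁻ x, f x) * (∫⁻ x, g x) ≤ (∫⁻ x, h x) ^ 2 := by
  set a := ⨆ x, f x with ha
  set b := ⨆ x, g x with hb
  by_cases ha0 : a = 0
  · have : ∀ x, f x = 0 := fun x => le_antisymm ((le_iSup f x).trans ha0.le) zero_le
    simp [this]
  by_cases hb0 : b = 0
  · have : ∀ x, g x = 0 := fun x => le_antisymm ((le_iSup g x).trans hb0.le) zero_le
    simp [this]
  set s : ENNReal := (a * b) ^ (1 / 2 : ℝ) with hs
  have hs2 : s ^ 2 = a * b := by
    rw [hs, ← ENNReal.rpow_natCast, ← ENNReal.rpow_mul]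
    norm_num
  have hab0 : a * b ≠ 0 := mul_ne_zero ha0 hb0
  have habt : a * b ≠ ⊤ := ENNReal.mul_ne_top hfs hgs
  have key := lintegral_add_lintegral_le_of_midpoint (f := fun x => f x * a⁻¹)
    (g := fun x => g x * b⁻¹) (h := fun x => h x * s⁻¹) (hf.mul_const _) (hg.mul_const _)
    (hh.mul_const _) (by rw [← ENNReal.iSup_mul, ← ha, ENNReal.mul_inv_cancel ha0 hfs])
    (by rw [← ENNReal.iSup_mul, ← hb, ENNReal.mul_inv_cancel hb0 hgs]) (by
      intro x y
      calc f x * a⁻¹ * (g y * b⁻¹) = f x * g y * (a * b)⁻¹ := by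
            rw [ENNReal.mul_inv (Or.inl ha0) (Or.inl hfs)]; ring
        _ ≤ h ((x + y) / 2) ^ 2 * (a * b)⁻¹ := by gcongr; exact H x y
        _ = (h ((x + y) / 2) * s⁻¹) ^ 2 := by rw [mul_pow, ← hs2, ENNReal.inv_pow])
  have := mul_le_sq_of_midpoint_add_le key
  rw [lintegral_mul_const _ hf, lintegral_mul_const _ hg, lintegral_mul_const _ hh, mul_pow,
    ← ENNReal.inv_pow, hs2] at this
  calc (∫⁻ x, f x) * (∫⁻ x, g x)
      = ((∫⁻ x, f x) * a⁻¹ * ((∫⁻ x, g x) * b⁻¹)) * (a * b) := by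
        have e1 : a⁻¹ * a = 1 := ENNReal.inv_mul_cancel ha0 hfs
        have e2 : b⁻¹ * b = 1 := ENNReal.inv_mul_cancel hb0 hgs
        calc _ = (∫⁻ x, f x) * (∫⁻ x, g x) * (a⁻¹ * a) * (b⁻¹ * b) := by rw [e1, e2]; simp
          _ = _ := by ring
    _ ≤ ((∫⁻ x, h x) ^ 2 * (a * b)⁻¹) * (a * b) := by gcongr
    _ = _ := by rw [mul_assoc, ENNReal.inv_mul_cancel hab0 habt, mul_one]

theorem prekopaLeindler_real {f g h : ℝ → ENNReal} (hf : Measurable f)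
    (hg : Measurable g) (hh : Measurable h) (H : ∀ x y, f x * g y ≤ h ((x + y) / 2) ^ 2) :
    (∫⁻ x, f x) * (∫⁻ x, g x) ≤ (∫⁻ x, h x) ^ 2 := by
  -- Truncating f and g at integer heights only weakens the hypothesis, so h can stay fixed and
  -- monotone convergence removes the boundedness assumption.
  have trunc : ∀ f : ℝ → ENNReal, Measurable f →
      ∫⁻ x, f x = ⨆ k : ℕ, ∫⁻ x, min (f x) k := by
    intro f hf
    rw [← lintegral_iSup (fun k => hf.min measurable_const)]
    · refine lintegral_congr fun x => ?_
      have h1 : ⨆ k : ℕ, (k : ENNReal) = ⊤ := ENNReal.iSup_natCast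
      have h2 : ⨆ k : ℕ, min (f x) (k : ENNReal) = min (f x) (⨆ k : ℕ, (k : ENNReal)) :=
        (inf_iSup_eq _ _).symm
      rw [h2, h1, min_top_right]
    · intro k l hkl x
      exact min_le_min_left _ (by exact_mod_cast hkl)
  have hb : ∀ (f : ℝ → ENNReal) (k : ℕ), ⨆ x, min (f x) (k : ENNReal) ≠ ⊤ := fun f k =>
    ne_top_of_le_ne_top (ENNReal.natCast_ne_top k) (iSup_le fun x => min_le_right _ _)
  rw [trunc f hf, trunc g hg, ENNReal.iSup_mul]
  refine iSup_le fun k => ?_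
  rw [ENNReal.mul_iSup]
  refine iSup_le fun l => ?_
  exact prekopaLeindler_real_of_bdd (hf.min measurable_const) (hg.min measurable_const) hh
    (hb f k) (hb g l) fun x y => le_trans (mul_le_mul' (min_le_left _ _) (min_le_left _ _)) (H x y)

/-- The hypothesis passes to marginals: for fixed first coordinates s, t the induction hypothesis on
the remaining ones is exactly the one-dimensional hypothesis for the partial integrals. -/
theorem prekopaLeindler {m : ℕ} {f g h : (Fin m → ℝ) → ENNReal} (hf : Measurable f)
    (hg : Measurable g) (hh : Measurable h)
    (H : ∀ x y, f x * g y ≤ h ((1 / 2 : ℝ) • (x + y)) ^ 2) :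
    (∫⁻ x, f x) * (∫⁻ x, g x) ≤ (∫⁻ x, h x) ^ 2 := by
  induction m with
  | zero =>
    have d0 : ∀ x : Fin 0 → ℝ, x = default := fun x => Subsingleton.elim _ _
    have := H default default
    have hv : (volume : Measure (Fin 0 → ℝ)) Set.univ = 1 := by simp [volume_pi]
    rw [Subsingleton.elim ((1 / 2 : ℝ) • (default + default)) (default : Fin 0 → ℝ)] at this
    simp only [lintegral_unique, hv, mul_one]
    convert this
  | succ m ih =>
    have e := (volume_preserving_piFinSuccAbove (fun _ : Fin (m + 1) => ℝ) 0).symm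
    have key : ∀ f : (Fin (m + 1) → ℝ) → ENNReal, Measurable f →
        ∫⁻ x, f x = ∫⁻ s : ℝ, ∫⁻ y : Fin m → ℝ, f (Fin.insertNth 0 s y) := by
      intro f hf
      rw [← e.lintegral_comp hf, Measure.volume_eq_prod, lintegral_prod]
      · rfl
      · exact (hf.comp (MeasurableEquiv.measurable _)).aemeasurable
    have hcons : Measurable fun p : ℝ × (Fin m → ℝ) => (Fin.insertNth (α := fun _ => ℝ) 0 p.1 p.2 : Fin (m + 1) → ℝ) :=
      MeasurableEquiv.measurable (MeasurableEquiv.piFinSuccAbove (fun _ : Fin (m + 1) => ℝ) 0).symm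
    rw [key f hf, key g hg, key h hh]
    apply prekopaLeindler_real
    · exact (hf.comp hcons).lintegral_prod_right'
    · exact (hg.comp hcons).lintegral_prod_right'
    · exact (hh.comp hcons).lintegral_prod_right'
    · intro s t
      apply ih
      · exact hf.comp (hcons.comp (measurable_const.prodMk measurable_id))
      · exact hg.comp (hcons.comp (measurable_const.prodMk measurable_id))
      · exact hh.comp (hcons.comp (measurable_const.prodMk measurable_id))
      · intro x y
        have := H (Fin.insertNth 0 s x) (Fin.insertNth 0 t y)
        convert this using 3
        ext i
        refine Fin.cases ?_ (fun i => ?_) i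
        · simp; ring
        · simp; ring

/-! ### The truncated normal distribution: normalization and moment generating function -/

variable {m : ℕ} {K : Matrix (Fin m) (Fin m) ℝ}

/-- The unnormalized Gaussian density. -/
noncomputable def gaussWeight (K : Matrix (Fin m) (Fin m) ℝ) (x : Fin m → ℝ) : ℝ :=
  Real.exp (-(1 / 2) * (x ⬝ᵥ (K *ᵥ x)))

/-- The closed nonnegative orthant. -/
def orthant (m : ℕ) : Set (Fin m → ℝ) := {x | ∀ j, 0 ≤ x j}

theorem measurableSet_orthant : MeasurableSet (orthant m) := by
  have : orthant m = ⋂ j, {x | 0 ≤ x j} := by ext; simp [orthant]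
  rw [this]
  exact MeasurableSet.iInter fun j => measurableSet_le measurable_const (measurable_pi_apply j)

@[fun_prop]
theorem continuous_gaussWeight : Continuous (gaussWeight K) := by
  unfold gaussWeight
  fun_prop

theorem gaussWeight_pos (x : Fin m → ℝ) : 0 < gaussWeight K x := Real.exp_pos _

theorem truncNormalWeight_zero : truncNormalWeight 0 K =
    (volume.restrict (orthant m)).withDensity (fun x => ENNReal.ofReal (gaussWeight K x)) := by
  simp [truncNormalWeight, gaussWeight, orthant]

/-- A continuous positive function on the compact Euclidean unit sphere has a positive minimum, and
homogeneity extends the bound. -/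
theorem exists_quadForm_lower_bound {ι : Type*} [Fintype ι] {A : Matrix ι ι ℝ}
    (hA : ∀ x, x ≠ 0 → 0 < x ⬝ᵥ (A *ᵥ x)) :
    ∃ c : ℝ, 0 < c ∧ ∀ x : ι → ℝ, c * ∑ i, x i ^ 2 ≤ x ⬝ᵥ (A *ᵥ x) := by
  set S : Set (ι → ℝ) := {x | ∑ i, x i ^ 2 = 1} with hS
  have hcl : IsClosed S := isClosed_eq (by fun_prop) continuous_const
  have hbd : S ⊆ Metric.closedBall 0 1 := by
    intro x hx
    rw [mem_closedBall_zero_iff, pi_norm_le_iff_of_nonneg zero_le_one]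
    intro i
    have : x i ^ 2 ≤ ∑ i, x i ^ 2 :=
      Finset.single_le_sum (f := fun i => x i ^ 2) (fun i _ => sq_nonneg _) (Finset.mem_univ i)
    rw [show ∑ i, x i ^ 2 = 1 from hx] at this
    exact (sq_le_one_iff_abs_le_one _).1 this
  have hc : IsCompact S := (isCompact_closedBall _ _).of_isClosed_subset hcl hbd
  have hpos : ∀ x : ι → ℝ, x ≠ 0 → 0 < ∑ i, x i ^ 2 := by
    intro x hx
    obtain ⟨i, hi⟩ := Function.ne_iff.1 hx
    exact Finset.sum_pos' (fun i _ => sq_nonneg _) ⟨i, Finset.mem_univ i, by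
      have : x i ≠ 0 := hi
      positivity⟩
  have hscale : ∀ (x : ι → ℝ) (t : ℝ), (t • x) ⬝ᵥ (A *ᵥ (t • x)) = t ^ 2 * (x ⬝ᵥ (A *ᵥ x)) := by
    intro x t
    rw [Matrix.mulVec_smul, smul_dotProduct, dotProduct_smul, smul_eq_mul, smul_eq_mul]; ring
  have hnorm : ∀ x : ι → ℝ, x ≠ 0 → (√(∑ i, x i ^ 2))⁻¹ • x ∈ S := by
    intro x hx
    simp only [hS, Set.mem_ofPred_eq, Pi.smul_apply, smul_eq_mul, mul_pow, ← Finset.mul_sum,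
      inv_pow, Real.sq_sqrt (hpos x hx).le]
    exact inv_mul_cancel₀ (hpos x hx).ne'
  -- The sphere is empty when the index type is.
  rcases S.eq_empty_or_nonempty with h0 | h0
  · refine ⟨1, one_pos, fun x => ?_⟩
    by_cases hx : x = 0
    · simp [hx]
    · exact absurd (hnorm x hx) (by simp [h0])
  · obtain ⟨x₀, hx₀, hmin⟩ := hc.exists_isMinOn h0
      (f := fun x => x ⬝ᵥ (A *ᵥ x)) (by fun_prop)
    have hx₀0 : x₀ ≠ 0 := by
      rintro rfl
      simp [hS] at hx₀
    refine ⟨_, hA x₀ hx₀0, fun x => ?_⟩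
    by_cases hx : x = 0
    · simp [hx]
    have h1 : x₀ ⬝ᵥ (A *ᵥ x₀) ≤ _ := hmin (hnorm x hx)
    beta_reduce at h1
    rw [hscale, inv_pow, Real.sq_sqrt (hpos x hx).le] at h1
    calc _ ≤ ((∑ i, x i ^ 2)⁻¹ * (x ⬝ᵥ (A *ᵥ x))) * ∑ i, x i ^ 2 :=
          mul_le_mul_of_nonneg_right h1 (hpos x hx).le
      _ = _ := by field_simp [(hpos x hx).ne']

theorem quadForm_pos (hK : K.PosDef) (x : Fin m → ℝ) (hx : x ≠ 0) : 0 < x ⬝ᵥ (K *ᵥ x) := by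
  simpa using hK.dotProduct_mulVec_pos hx

theorem integrable_exp_mul_gaussWeight (hK : K.PosDef) (a : ℝ) (j : Fin m) :
    Integrable fun x : Fin m → ℝ => Real.exp (a * x j) * gaussWeight K x := by
  obtain ⟨c, hc, hQ⟩ := exists_quadForm_lower_bound (quadForm_pos hK)
  have h1 : Integrable fun x : Fin m → ℝ =>
      Real.exp (a ^ 2 / c) * ∏ i, Real.exp (-(c / 4) * x i ^ 2) := by
    refine Integrable.const_mul ?_ _
    exact Integrable.fintype_prod (f := fun _ (t : ℝ) => Real.exp (-(c / 4) * t ^ 2))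
      fun _ => integrable_exp_neg_mul_sq (by positivity)
  refine h1.mono' (by fun_prop) (Eventually.of_forall fun x => ?_)
  rw [Real.norm_of_nonneg (by have := gaussWeight_pos (K := K) x; positivity), gaussWeight,
    ← Real.exp_sum, ← Real.exp_add, ← Real.exp_add, Real.exp_le_exp, ← Finset.mul_sum]
  have h2 := hQ x
  have h3 : x j ^ 2 ≤ ∑ i, x i ^ 2 :=
    Finset.single_le_sum (f := fun i => x i ^ 2) (fun i _ => sq_nonneg _) (Finset.mem_univ j)
  have h4 : a * x j ≤ a ^ 2 / c + c / 4 * x j ^ 2 := by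
    have : 0 ≤ (a / c - x j / 2) ^ 2 * c := by positivity
    have e : (a / c - x j / 2) ^ 2 * c = a ^ 2 / c + c / 4 * x j ^ 2 - a * x j := by
      field_simp; ring
    linarith
  have h5 : c / 4 * x j ^ 2 ≤ c / 4 * ∑ i, x i ^ 2 := by gcongr
  linarith

theorem integrable_gaussWeight (hK : K.PosDef) : Integrable (gaussWeight K) := by
  obtain ⟨c, hc, hQ⟩ := exists_quadForm_lower_bound (quadForm_pos hK)
  have h1 : Integrable fun x : Fin m → ℝ => ∏ i, Real.exp (-(c / 2) * x i ^ 2) :=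
    Integrable.fintype_prod (f := fun _ (t : ℝ) => Real.exp (-(c / 2) * t ^ 2))
      fun _ => integrable_exp_neg_mul_sq (by positivity)
  refine h1.mono' (by fun_prop) (Eventually.of_forall fun x => ?_)
  rw [Real.norm_of_nonneg (gaussWeight_pos x).le, gaussWeight,
    ← Real.exp_sum, Real.exp_le_exp, ← Finset.mul_sum]
  have h2 := hQ x
  linarith

theorem truncNormalWeight_univ : truncNormalWeight 0 K Set.univ =
    ∫⁻ x in orthant m, ENNReal.ofReal (gaussWeight K x) := by
  rw [truncNormalWeight_zero, withDensity_apply _ MeasurableSet.univ, Measure.restrict_univ]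

theorem truncNormalWeight_univ_ne_top (hK : K.PosDef) :
    truncNormalWeight 0 K Set.univ ≠ ⊤ := by
  rw [truncNormalWeight_univ]
  exact (integrable_gaussWeight hK).integrableOn.lintegral_lt_top.ne

theorem volume_orthant_ne_zero : volume (orthant m) ≠ 0 := by
  have h : Set.pi Set.univ (fun _ : Fin m => Set.Ioo (0 : ℝ) 1) ⊆ orthant m :=
    fun x hx j => (hx j (Set.mem_univ j)).1.le
  intro h0
  have := measure_mono_null h h0
  rw [volume_pi_pi] at this
  simp at this

theorem truncNormalWeight_univ_ne_zero : truncNormalWeight 0 K Set.univ ≠ 0 := by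
  rw [truncNormalWeight_univ]
  intro h
  rw [lintegral_eq_zero_iff (by fun_prop)] at h
  have : ∀ᵐ x ∂(volume.restrict (orthant m)), False := by
    filter_upwards [h] with x hx
    simp only [Pi.zero_apply, ENNReal.ofReal_eq_zero] at hx
    exact absurd (gaussWeight_pos x) (not_lt.2 hx)
  rw [ae_iff] at this
  simp at this
  exact volume_orthant_ne_zero this

theorem isProbabilityMeasure_truncNormal (hK : K.PosDef) :
    IsProbabilityMeasure (truncNormal 0 K) := by
  constructor
  rw [truncNormal, Measure.smul_apply, smul_eq_mul]
  exact ENNReal.inv_mul_cancel truncNormalWeight_univ_ne_zero (truncNormalWeight_univ_ne_top hK)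

theorem truncNormal_absolutelyContinuous :
    truncNormal 0 K ≪ volume.restrict (orthant m) := by
  rw [truncNormal, truncNormalWeight_zero]
  exact (Measure.smul_absolutelyContinuous).trans (withDensity_absolutelyContinuous _ _)

theorem lintegral_truncNormal {f : (Fin m → ℝ) → ENNReal} :
    ∫⁻ x, f x ∂(truncNormal 0 K) = (truncNormalWeight 0 K Set.univ)⁻¹ *
      ∫⁻ x in orthant m, ENNReal.ofReal (gaussWeight K x) * f x := by
  rw [truncNormal, lintegral_smul_measure, truncNormalWeight_zero,
    lintegral_withDensity_eq_lintegral_mul_non_measurable _ (by fun_prop)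
      (Eventually.of_forall fun _ => ENNReal.ofReal_lt_top)]
  rfl

theorem integrable_truncNormal_iff (hK : K.PosDef) {f : (Fin m → ℝ) → ℝ} :
    Integrable f (truncNormal 0 K) ↔ IntegrableOn (fun x => f x * gaussWeight K x) (orthant m) := by
  rw [truncNormal, integrable_smul_measure
    (ENNReal.inv_ne_zero.2 (truncNormalWeight_univ_ne_top hK))
    (ENNReal.inv_ne_top.2 truncNormalWeight_univ_ne_zero), truncNormalWeight_zero,
    integrable_withDensity_iff (by fun_prop) (Eventually.of_forall fun _ => ENNReal.ofReal_lt_top)]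
  simp only [ENNReal.toReal_ofReal (gaussWeight_pos _).le]
  rfl

theorem integral_truncNormal {f : (Fin m → ℝ) → ℝ} :
    ∫ x, f x ∂(truncNormal 0 K) = ((truncNormalWeight 0 K Set.univ)⁻¹).toReal *
      ∫ x in orthant m, f x * gaussWeight K x := by
  rw [truncNormal, integral_smul_measure, truncNormalWeight_zero,
    integral_withDensity_eq_integral_toReal_smul (by fun_prop)
      (Eventually.of_forall fun _ => ENNReal.ofReal_lt_top)]
  simp only [ENNReal.toReal_ofReal (gaussWeight_pos _).le, smul_eq_mul, mul_comm]

theorem ae_truncNormal_pos : ∀ᵐ x ∂(truncNormal 0 K), ∀ j, 0 < x j := by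
  apply truncNormal_absolutelyContinuous.ae_le
  have h1 : ∀ᵐ x ∂(volume : Measure (Fin m → ℝ)), ∀ j, x j ≠ 0 := by
    rw [ae_all_iff]
    intro j
    exact (Measure.quasiMeasurePreserving_eval (fun _ : Fin m => (volume : Measure ℝ)) j).ae
      (Measure.ae_ne volume 0)
  filter_upwards [ae_restrict_of_ae h1, ae_restrict_mem measurableSet_orthant] with x h h' j
  exact lt_of_le_of_ne (h' j) (h j).symm

theorem ae_truncNormal_of_ae_Ioi {p : ℝ → Prop}
    (hp : ∀ᵐ x ∂(volume.restrict (Set.Ioi (0 : ℝ))), p x) (j : Fin m) :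
    ∀ᵐ x ∂(truncNormal 0 K), p (x j) := by
  rw [ae_restrict_iff' measurableSet_Ioi] at hp
  have h1 : ∀ᵐ x ∂(volume : Measure (Fin m → ℝ)), x j ∈ Set.Ioi 0 → p (x j) :=
    (Measure.quasiMeasurePreserving_eval (fun _ : Fin m => (volume : Measure ℝ)) j).ae hp
  filter_upwards [truncNormal_absolutelyContinuous.ae_le (ae_restrict_of_ae h1),
    ae_truncNormal_pos] with x h h'
  exact h (h' j)

/-- By the parallelogram identity, averaging the exponents at x and y gains ¼(x - y)ᵀK(x - y) over
the midpoint. This quadratic gain absorbs the tilt a(x_j - y_j) up to the constant a² (K⁻¹)_jj. -/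
theorem lintegral_exp_mul_lintegral_exp_neg_le (hK : K.PosDef) (a : ℝ) (j : Fin m) :
    (∫⁻ x, ENNReal.ofReal (Real.exp (a * x j)) ∂(truncNormal 0 K)) *
      (∫⁻ x, ENNReal.ofReal (Real.exp (-a * x j)) ∂(truncNormal 0 K)) ≤
    ENNReal.ofReal (Real.exp (a ^ 2 * K⁻¹ j j)) := by
  set σ := K⁻¹ j j with hσ
  set Z := truncNormalWeight 0 K Set.univ with hZ
  have hquad : ∀ z : Fin m → ℝ, a * z j - a ^ 2 * σ ≤ 1 / 4 * (z ⬝ᵥ (K *ᵥ z)) := by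
    intro z
    have hdet : IsUnit K.det := hK.det_pos.ne'.isUnit
    set e : Fin m → ℝ := K⁻¹ *ᵥ Pi.single j 1 with he
    have hKe : K *ᵥ e = Pi.single j 1 := by
      rw [he, Matrix.mulVec_mulVec, Matrix.mul_nonsing_inv _ hdet, Matrix.one_mulVec]
    have hKt : Kᵀ = K := by
      have := hK.isHermitian.eq
      simpa only [Matrix.conjTranspose_eq_transpose_of_trivial] using this
    have hej : e j = σ := by simp [he, hσ]
    -- Completing the square: with e = K⁻¹e_j, the form at z/2 - a e equals ¼zᵀKz - a z_j + a²σ.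
    have h := hK.posSemidef.dotProduct_mulVec_nonneg ((1 / 2 : ℝ) • z - a • e)
    have hez : e ⬝ᵥ (K *ᵥ z) = z j := by
      rw [Matrix.dotProduct_mulVec, ← Matrix.mulVec_transpose, hKt, hKe]; simp
    simp only [star_trivial, Matrix.mulVec_sub, Matrix.mulVec_smul, hKe, dotProduct_sub,
      sub_dotProduct, dotProduct_smul, smul_dotProduct, smul_eq_mul, hez,
      dotProduct_single, Pi.sub_apply, Pi.smul_apply, hej] at h
    nlinarith [h]
  have hpl := prekopaLeindler (m := m)
    (f := (orthant m).indicator fun x => ENNReal.ofReal (gaussWeight K x) *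
      ENNReal.ofReal (Real.exp (a * x j)))
    (g := (orthant m).indicator fun x => ENNReal.ofReal (gaussWeight K x) *
      ENNReal.ofReal (Real.exp (-a * x j)))
    (h := (orthant m).indicator fun x => ENNReal.ofReal (gaussWeight K x) *
      ENNReal.ofReal (Real.exp (a ^ 2 * σ / 2)))
    (Measurable.indicator (by fun_prop) measurableSet_orthant)
    (Measurable.indicator (by fun_prop) measurableSet_orthant)
    (Measurable.indicator (by fun_prop) measurableSet_orthant) (by
      intro x y
      by_cases hx : x ∈ orthant m
      swap; · simp [hx]
      by_cases hy : y ∈ orthant m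
      swap; · simp [hy]
      have hxy : (1 / 2 : ℝ) • (x + y) ∈ orthant m := fun i => by
        have := hx i; have := hy i
        simp only [Pi.smul_apply, Pi.add_apply, smul_eq_mul]; linarith
      rw [Set.indicator_of_mem hx, Set.indicator_of_mem hy, Set.indicator_of_mem hxy]
      simp only [← ENNReal.ofReal_mul (gaussWeight_pos _).le]
      rw [← ENNReal.ofReal_mul (by have := gaussWeight_pos (K := K) x; positivity),
        ← ENNReal.ofReal_pow (by have := gaussWeight_pos (K := K) ((1 / 2 : ℝ) • (x + y)); positivity)]
      refine ENNReal.ofReal_le_ofReal ?_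
      simp only [gaussWeight, ← Real.exp_add, ← Real.exp_nat_mul]
      rw [Real.exp_le_exp]
      have h := hquad (x - y)
      simp only [Matrix.mulVec_sub, Matrix.mulVec_add, Matrix.mulVec_smul, dotProduct_sub,
        dotProduct_add, add_dotProduct, 
        sub_dotProduct, dotProduct_smul, smul_dotProduct, smul_eq_mul, Pi.sub_apply] at h ⊢
      push_cast
      linarith)
  simp only [lintegral_indicator measurableSet_orthant] at hpl
  rw [lintegral_mul_const _ (by fun_prop), ← truncNormalWeight_univ, ← hZ] at hpl
  rw [lintegral_truncNormal, lintegral_truncNormal, ← hZ]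
  have hZ0 : Z ≠ 0 := truncNormalWeight_univ_ne_zero
  have hZt : Z ≠ ⊤ := truncNormalWeight_univ_ne_top hK
  calc _ = Z⁻¹ * Z⁻¹ * ((∫⁻ x in orthant m, ENNReal.ofReal (gaussWeight K x) *
        ENNReal.ofReal (Real.exp (a * x j))) * (∫⁻ x in orthant m, 
        ENNReal.ofReal (gaussWeight K x) * ENNReal.ofReal (Real.exp (-a * x j)))) := by ring
    _ ≤ Z⁻¹ * Z⁻¹ * (Z * ENNReal.ofReal (Real.exp (a ^ 2 * σ / 2))) ^ 2 := by gcongr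
    _ = (Z⁻¹ * Z) * (Z⁻¹ * Z) * ENNReal.ofReal (Real.exp (a ^ 2 * σ / 2)) ^ 2 := by ring
    _ = _ := by
      rw [ENNReal.inv_mul_cancel hZ0 hZt, ← ENNReal.ofReal_pow (Real.exp_pos _).le,
        ← Real.exp_nat_mul, one_mul, one_mul]
      congr 2
      push_cast; ring

theorem integrable_exp_truncNormal (hK : K.PosDef) (a : ℝ) (j : Fin m) :
    Integrable (fun x => Real.exp (a * x j)) (truncNormal 0 K) :=
  (integrable_truncNormal_iff hK).2 (integrable_exp_mul_gaussWeight hK a j).integrableOn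

theorem integrable_coord_truncNormal (hK : K.PosDef) (j : Fin m) :
    Integrable (fun x => x j) (truncNormal 0 K) := by
  refine ((integrable_exp_truncNormal hK 1 j)).mono'
    (measurable_pi_apply j).aestronglyMeasurable ?_
  filter_upwards [ae_truncNormal_pos] with x hx
  rw [Real.norm_of_nonneg (hx j).le]
  have := Real.add_one_le_exp (1 * x j)
  linarith

theorem integral_exp_le (hK : K.PosDef) (a : ℝ) (j : Fin m) :
    ∫ x, Real.exp (a * x j) ∂(truncNormal 0 K) ≤
      Real.exp (a * (∫ x, x j ∂(truncNormal 0 K)) + a ^ 2 * K⁻¹ j j) := by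
  have := isProbabilityMeasure_truncNormal hK
  set μ := ∫ x, x j ∂(truncNormal 0 K) with hμ
  have h1 := lintegral_exp_mul_lintegral_exp_neg_le hK a j
  rw [← ofReal_integral_eq_lintegral_ofReal (integrable_exp_truncNormal hK a j)
    (Eventually.of_forall fun x => (Real.exp_pos _).le),
    ← ofReal_integral_eq_lintegral_ofReal (integrable_exp_truncNormal hK (-a) j)
    (Eventually.of_forall fun x => (Real.exp_pos _).le),
    ← ENNReal.ofReal_mul (integral_nonneg fun x => (Real.exp_pos _).le),
    ENNReal.ofReal_le_ofReal_iff (Real.exp_pos _).le] at h1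
  -- Jensen's inequality, through the tangent line of the exponential at μ.
  have h2 : Real.exp (-a * μ) ≤ ∫ x, Real.exp (-a * x j) ∂(truncNormal 0 K) := by
    have hi := integrable_coord_truncNormal hK j
    have : ∫ x, Real.exp (-a * μ) * (1 + (-a) * (x j - μ)) ∂(truncNormal 0 K) ≤
        ∫ x, Real.exp (-a * x j) ∂(truncNormal 0 K) := by
      refine integral_mono ?_ (integrable_exp_truncNormal hK (-a) j) fun x => ?_
      · exact ((integrable_const _).add ((hi.sub (integrable_const _)).const_mul _)).const_mul _
      · have h3 := Real.add_one_le_exp (-a * (x j - μ))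
        calc Real.exp (-a * μ) * (1 + (-a) * (x j - μ))
            ≤ Real.exp (-a * μ) * Real.exp (-a * (x j - μ)) := by gcongr; linarith
          _ = _ := by rw [← Real.exp_add]; congr 1; ring
    have hs : Integrable (fun x : Fin m → ℝ => x j - μ) (truncNormal 0 K) :=
      hi.sub (integrable_const _)
    rw [integral_const_mul, integral_add (integrable_const _) (hs.const_mul _),
      integral_const_mul, integral_sub hi (integrable_const _)] at this
    simpa [← hμ] using this
  have h3 : (∫ x, Real.exp (a * x j) ∂(truncNormal 0 K)) * Real.exp (-a * μ) ≤
      Real.exp (a ^ 2 * K⁻¹ j j) :=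
    (mul_le_mul_of_nonneg_left h2 (integral_nonneg fun x => (Real.exp_pos _).le)).trans h1
  calc _ = (∫ x, Real.exp (a * x j) ∂(truncNormal 0 K)) * Real.exp (-a * μ) * Real.exp (a * μ) := by
        rw [mul_assoc, ← Real.exp_add]; simp
    _ ≤ Real.exp (a ^ 2 * K⁻¹ j j) * Real.exp (a * μ) := by gcongr
    _ = _ := by rw [← Real.exp_add, add_comm]

section TruncNormalTails

variable {m : ℕ} {K : Matrix (Fin m) (Fin m) ℝ}

/-! ### Exponential moments of the truncated normal distribution in terms of `cX` -/

theorem two_mul_le_cX (j : Fin m) :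
    2 * (2 * √(K⁻¹ j j) + √(Real.exp 1) * ∫ x, x j ∂(truncNormal 0 K)) ≤ cX K := by
  unfold cX
  gcongr
  exact le_ciSup (f := fun j => 2 * √(K⁻¹ j j) + √(Real.exp 1) * ∫ x, x j ∂(truncNormal 0 K))
    (Set.finite_range _).bddAbove j

theorem integral_coord_nonneg (j : Fin m) : 0 ≤ ∫ x, x j ∂(truncNormal 0 K) :=
  integral_nonneg_of_ae (ae_truncNormal_pos.mono fun _ hx => (hx j).le)

theorem one_le_sqrt_exp_one : 1 ≤ √(Real.exp 1) := by
  rw [Real.one_le_sqrt]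
  exact Real.one_le_exp zero_le_one

theorem integral_coord_le (j : Fin m) : ∫ x, x j ∂(truncNormal 0 K) ≤ cX K / 2 := by
  have h1 := two_mul_le_cX (K := K) j
  have h2 := integral_coord_nonneg (K := K) j
  have h3 := mul_le_mul_of_nonneg_right one_le_sqrt_exp_one h2
  have h4 := Real.sqrt_nonneg (K⁻¹ j j)
  linarith

theorem inv_diag_pos (hK : K.PosDef) (j : Fin m) : 0 < K⁻¹ j j := hK.inv.diag_pos

theorem sqrt_inv_diag_le (j : Fin m) : √(K⁻¹ j j) ≤ cX K / 4 := by
  have h1 := two_mul_le_cX (K := K) j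
  have h2 := integral_coord_nonneg (K := K) j
  have h3 := mul_le_mul_of_nonneg_right one_le_sqrt_exp_one h2
  linarith

theorem cX_pos (hK : K.PosDef) (j : Fin m) : 0 < cX K := by
  have h1 := sqrt_inv_diag_le (K := K) j
  have h2 := Real.sqrt_pos.2 (inv_diag_pos hK j)
  linarith

theorem integral_exp_le_cX (hK : K.PosDef) {a : ℝ} (ha : 0 ≤ a) (j : Fin m) :
    ∫ x, Real.exp (a * x j) ∂(truncNormal 0 K) ≤ Real.exp (a * cX K / 2 + a ^ 2 * cX K ^ 2 / 16) := by
  refine (integral_exp_le hK a j).trans (Real.exp_le_exp.2 ?_)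
  have h1 := mul_le_mul_of_nonneg_left (integral_coord_le (K := K) j) ha
  have h2 : K⁻¹ j j ≤ (cX K / 4) ^ 2 := by
    rw [← Real.sq_sqrt (inv_diag_pos hK j).le]
    have := sqrt_inv_diag_le (K := K) j
    gcongr
  have h3 := mul_le_mul_of_nonneg_left h2 (sq_nonneg a)
  linarith

/-- Bound x^(2q) by (2q)! a^(-2q) exp(ax) and take a = √(2q)/c_X, for which the exponential moment
is at most e^(2q) ≤ 8^q. Splitting (2q)! ≤ 4^q q! q^q cancels the q^q in a^(2q) and leaves a single
q!, the Gaussian growth rate. -/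
theorem integral_pow_le_cX (hK : K.PosDef) (j : Fin m) (q : ℕ) :
    ∫⁻ x, ENNReal.ofReal (x j ^ (2 * q)) ∂(truncNormal 0 K) ≤
      ENNReal.ofReal (q.factorial * (16 * cX K ^ 2) ^ q) := by
  have := isProbabilityMeasure_truncNormal hK
  rcases Nat.eq_zero_or_pos q with rfl | hq
  · simp
  have hc := cX_pos hK j
  set c := cX K with hcdef
  have hq' : (0 : ℝ) < q := by exact_mod_cast hq
  have hq1 : (1 : ℝ) ≤ q := by exact_mod_cast hq
  set a : ℝ := √(2 * q) / c with ha
  have hapos : 0 < a := by positivity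
  have ha2 : a ^ 2 = 2 * q / c ^ 2 := by
    rw [ha, div_pow, Real.sq_sqrt (by positivity)]
  have hac : a * c = √(2 * q) := by rw [ha]; field_simp
  have hfac : ((2 * q).factorial : ℝ) ≤ 4 ^ q * q.factorial * q ^ q := by
    have h1 : (2 * q).factorial = q.centralBinom * q.factorial * q.factorial := by
      rw [Nat.centralBinom_eq_two_mul_choose]
      have := Nat.choose_mul_factorial_mul_factorial (show q ≤ 2 * q by omega)
      rw [show 2 * q - q = q by omega] at this
      exact this.symm
    have h2 : q.centralBinom ≤ 4 ^ q := by
      have := Nat.choose_le_two_pow (2 * q) q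
      rwa [pow_mul, ← Nat.centralBinom_eq_two_mul_choose] at this
    have h3 : q.factorial ≤ q ^ q := Nat.factorial_le_pow q
    rw [h1]
    exact_mod_cast Nat.mul_le_mul (Nat.mul_le_mul h2 le_rfl) h3
  have hexp : Real.exp (a * c / 2 + a ^ 2 * c ^ 2 / 16) ≤ 8 ^ q := by
    have h1 : a * c / 2 + a ^ 2 * c ^ 2 / 16 ≤ 2 * q := by
      have h2 : a ^ 2 * c ^ 2 = 2 * q := by rw [ha2]; field_simp
      have h3 : √(2 * q : ℝ) ≤ 2 * q := by
        rw [Real.sqrt_le_left (by positivity)]; nlinarith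
      rw [h2, hac]; linarith
    calc _ ≤ Real.exp (2 * q) := Real.exp_le_exp.2 h1
      _ = (Real.exp 1 ^ 2) ^ q := by rw [← pow_mul, ← Real.exp_nat_mul]; simp
      _ ≤ 8 ^ q := by
        have := Real.exp_one_lt_d9
        have h0 := Real.exp_pos 1
        gcongr
        nlinarith
  have hbound : ∀ᵐ x ∂(truncNormal 0 K), ENNReal.ofReal (x j ^ (2 * q)) ≤
      ENNReal.ofReal ((2 * q).factorial / a ^ (2 * q) * Real.exp (a * x j)) := by
    filter_upwards [ae_truncNormal_pos] with x hx
    refine ENNReal.ofReal_le_ofReal ?_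
    have h1 := Real.pow_div_factorial_le_exp (a * x j) (mul_nonneg hapos.le (hx j).le) (2 * q)
    have h2 : (0 : ℝ) < (2 * q).factorial := by positivity
    rw [div_le_iff₀ h2, mul_pow] at h1
    rw [div_mul_eq_mul_div, le_div_iff₀ (by positivity)]
    linarith
  refine (lintegral_mono_ae hbound).trans ?_
  rw [← ofReal_integral_eq_lintegral_ofReal ((integrable_exp_truncNormal hK a j).const_mul _)
    (Eventually.of_forall fun x => by positivity), integral_const_mul]
  refine ENNReal.ofReal_le_ofReal ?_
  have h1 := (integral_exp_le_cX hK hapos.le j).trans hexp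
  calc _ ≤ (4 ^ q * q.factorial * q ^ q) / a ^ (2 * q) * 8 ^ q := by gcongr
    _ = _ := by
      rw [pow_mul, ha2]
      rw [show (4 : ℝ) ^ q * q.factorial * q ^ q / (2 * q / c ^ 2) ^ q * 8 ^ q =
        q.factorial * ((4 * q * 8) ^ q / (2 * q / c ^ 2) ^ q) by rw [mul_pow, mul_pow]; ring,
        ← div_pow]
      congr 2
      field_simp
      norm_num

/-- The factorials cancel in the exponential series, and the constant 32 = 2 · 16 leaves a geometric
series of ratio 1/2. -/
theorem lintegral_exp_sq_le_two (hK : K.PosDef) (j : Fin m) :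
    ∫⁻ x, ENNReal.ofReal (Real.exp (x j ^ 2 / (32 * cX K ^ 2))) ∂(truncNormal 0 K) ≤ 2 := by
  have hc := cX_pos hK j
  set c := cX K with hcdef
  have h1 : ∀ x : Fin m → ℝ, ENNReal.ofReal (Real.exp (x j ^ 2 / (32 * c ^ 2))) =
      ∑' q : ℕ, ENNReal.ofReal ((q.factorial * (32 * c ^ 2) ^ q)⁻¹) *
        ENNReal.ofReal (x j ^ (2 * q)) := by
    intro x
    rw [Real.exp_eq_exp_ℝ, NormedSpace.exp_eq_tsum_div]
    rw [ENNReal.ofReal_tsum_of_nonneg (fun q => by positivity)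
      (NormedSpace.expSeries_div_summable (𝔸 := ℝ) _)]
    refine tsum_congr fun q => ?_
    rw [← ENNReal.ofReal_mul (by positivity)]
    congr 1
    rw [pow_mul, div_pow]
    field_simp
  simp only [h1]
  have hm : ∀ q : ℕ, Measurable fun x : Fin m → ℝ => ENNReal.ofReal (x j ^ (2 * q)) :=
    fun q => ENNReal.measurable_ofReal.comp ((measurable_pi_apply j).pow_const _)
  rw [lintegral_tsum (fun q => ((hm q).const_mul _).aemeasurable)]
  calc _ ≤ ∑' q : ℕ, (2⁻¹ : ENNReal) ^ q := by
        refine ENNReal.tsum_le_tsum fun q => ?_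
        rw [lintegral_const_mul _ (hm q)]
        refine (mul_le_mul_right (integral_pow_le_cX hK j q) _).trans ?_
        rw [← ENNReal.ofReal_mul (by positivity)]
        have : ((q.factorial * (32 * c ^ 2) ^ q : ℝ))⁻¹ * (q.factorial * (16 * c ^ 2) ^ q) =
            (2⁻¹ : ℝ) ^ q := by
          rw [show (32 * c ^ 2) ^ q = 2 ^ q * (16 * c ^ 2) ^ q by rw [← mul_pow]; ring, inv_pow]
          field_simp
        rw [this, ENNReal.ofReal_pow (by norm_num), ENNReal.ofReal_inv_of_pos (by norm_num)]
        simp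
    _ = 2 := by rw [ENNReal.tsum_geometric, ENNReal.one_sub_inv_two, inv_inv]

end TruncNormalTails

/-! ### Bernstein's inequality -/

section Bernstein

variable {E Ω : Type*} [MeasurableSpace E] [MeasurableSpace Ω]

/-- `φ` has exponential Orlicz norm at most `L` with respect to `ν`. -/
structure SubExp (φ : E → ℝ) (L : ℝ) (ν : Measure E) : Prop where
  aemeasurable : AEMeasurable φ ν
  pos : 0 < L
  lintegral_le : ∫⁻ x, ENNReal.ofReal (Real.exp (|φ x| / L)) ∂ν ≤ 2

variable {φ : E → ℝ} {L : ℝ} {ν : Measure E}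

theorem SubExp.integrable_exp (h : SubExp φ L ν) :
    Integrable (fun x => Real.exp (|φ x| / L)) ν := by
  have hm : AEMeasurable φ ν := h.aemeasurable
  refine ⟨(Real.measurable_exp.comp_aemeasurable
    ((continuous_abs.measurable.comp_aemeasurable hm).div_const L)).aestronglyMeasurable, ?_⟩
  rw [hasFiniteIntegral_iff_ofReal (Eventually.of_forall fun x => (Real.exp_pos _).le)]
  exact h.lintegral_le.trans_lt (by simp)

theorem SubExp.integral_exp_le (h : SubExp φ L ν) : ∫ x, Real.exp (|φ x| / L) ∂ν ≤ 2 := by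
  have h1 := h.lintegral_le
  rw [← ofReal_integral_eq_lintegral_ofReal h.integrable_exp
    (Eventually.of_forall fun x => (Real.exp_pos _).le)] at h1
  have : (2 : ENNReal) = ENNReal.ofReal 2 := by simp
  rw [this] at h1
  exact (ENNReal.ofReal_le_ofReal_iff (by norm_num)).1 h1

theorem SubExp.abs_le (h : SubExp φ L ν) (x : E) : |φ x| ≤ L * Real.exp (|φ x| / L) := by
  have h1 := Real.add_one_le_exp (|φ x| / L)
  have h2 : |φ x| = L * (|φ x| / L) := by field_simp [h.pos.ne']
  have h3 := h.pos
  calc |φ x| = L * (|φ x| / L) := h2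
    _ ≤ _ := by gcongr; linarith

theorem SubExp.integrable (h : SubExp φ L ν) : Integrable φ ν :=
  (h.integrable_exp.const_mul L).mono' h.aemeasurable.aestronglyMeasurable
    (Eventually.of_forall h.abs_le)

theorem SubExp.abs_integral_le (h : SubExp φ L ν) : |∫ x, φ x ∂ν| ≤ 2 * L := by
  calc |∫ x, φ x ∂ν| ≤ ∫ x, |φ x| ∂ν := abs_integral_le_integral_abs
    _ ≤ ∫ x, L * Real.exp (|φ x| / L) ∂ν :=
      integral_mono h.integrable.abs (h.integrable_exp.const_mul L) h.abs_le
    _ ≤ _ := by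
      rw [integral_const_mul]
      have := mul_le_mul_of_nonneg_left h.integral_exp_le h.pos.le
      linarith

theorem SubExp.neg (h : SubExp φ L ν) : SubExp (fun x => -φ x) L ν :=
  ⟨h.aemeasurable.neg, h.pos, by simpa using h.lintegral_le⟩

theorem exp_le_one_add_add_sq_mul_exp (x : ℝ) : Real.exp x ≤ 1 + x + x ^ 2 * Real.exp |x| := by
  have h := Complex.norm_exp_sub_sum_le_norm_mul_exp (x : ℂ) 2
  simp only [Finset.sum_range_succ, Finset.range_zero, Finset.sum_empty, pow_zero,
    Nat.factorial_zero, Nat.cast_one, div_one, zero_add, pow_one, Nat.factorial_one,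
    Complex.norm_real, Real.norm_eq_abs, sq_abs] at h
  have h2 : ‖Complex.exp x - (1 + x)‖ = |Real.exp x - (1 + x)| := by
    rw [← Real.norm_eq_abs, ← Complex.norm_real]
    push_cast
    rfl
  rw [h2] at h
  have := (le_abs_self _).trans h
  linarith

/-- The restriction on t spends half of the available exponent on exp|tφ|; the other half dominates
the square, as y² ≤ 8 exp(y/2). -/
theorem SubExp.exp_mul_le (h : SubExp φ L ν) {t : ℝ} (ht : |t| ≤ 1 / (2 * L)) (x : E) :
    Real.exp (t * φ x) ≤ 1 + t * φ x + 8 * (t * L) ^ 2 * Real.exp (|φ x| / L) := by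
  have hL := h.pos
  set y := |φ x| / L with hy
  have hy0 : 0 ≤ y := by positivity
  have h1 : |t * φ x| ≤ y / 2 := by
    rw [abs_mul]
    calc |t| * |φ x| ≤ 1 / (2 * L) * |φ x| := by gcongr
      _ = y / 2 := by rw [hy]; field_simp
  have h2 : (t * φ x) ^ 2 = (t * L) ^ 2 * y ^ 2 := by
    rw [hy, div_pow, sq_abs]; field_simp
  have h3 : y ^ 2 ≤ 8 * Real.exp (y / 2) := by
    have := Real.quadratic_le_exp_of_nonneg (show 0 ≤ y / 2 by positivity)
    nlinarith
  calc Real.exp (t * φ x) ≤ 1 + t * φ x + (t * φ x) ^ 2 * Real.exp |t * φ x| :=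
        exp_le_one_add_add_sq_mul_exp _
    _ ≤ 1 + t * φ x + (t * L) ^ 2 * (8 * Real.exp (y / 2)) * Real.exp (y / 2) := by
        rw [h2]; gcongr
    _ = _ := by
        rw [show y = y / 2 + y / 2 by ring, Real.exp_add]; ring_nf

theorem SubExp.integrable_exp_mul [IsFiniteMeasure ν] (h : SubExp φ L ν) {t : ℝ}
    (ht : |t| ≤ 1 / (2 * L)) : Integrable (fun x => Real.exp (t * φ x)) ν := by
  have hb : Integrable (fun x => 1 + t * φ x + 8 * (t * L) ^ 2 * Real.exp (|φ x| / L)) ν :=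
    ((integrable_const _).add (h.integrable.const_mul t)).add (h.integrable_exp.const_mul _)
  refine hb.mono' ?_ (Eventually.of_forall fun x => ?_)
  · exact (Real.measurable_exp.comp_aemeasurable (h.aemeasurable.const_mul t)).aestronglyMeasurable
  · rw [Real.norm_of_nonneg (Real.exp_pos _).le]
    exact h.exp_mul_le ht x

theorem SubExp.mgf_le [IsProbabilityMeasure ν] (h : SubExp φ L ν) {t : ℝ}
    (ht : |t| ≤ 1 / (2 * L)) :
    mgf φ ν t ≤ Real.exp (t * ∫ x, φ x ∂ν + 16 * (t * L) ^ 2) := by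
  have h1 : Integrable (fun x => 1 + t * φ x) ν := (integrable_const _).add (h.integrable.const_mul t)
  calc mgf φ ν t ≤ ∫ x, (1 + t * φ x + 8 * (t * L) ^ 2 * Real.exp (|φ x| / L)) ∂ν :=
        integral_mono (h.integrable_exp_mul ht) (h1.add (h.integrable_exp.const_mul _))
          (h.exp_mul_le ht)
    _ = 1 + t * ∫ x, φ x ∂ν + 8 * (t * L) ^ 2 * ∫ x, Real.exp (|φ x| / L) ∂ν := by
        rw [integral_add h1 (h.integrable_exp.const_mul _), integral_const_mul,
          integral_add (integrable_const _) (h.integrable.const_mul t), integral_const_mul]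
        simp
    _ ≤ 1 + t * ∫ x, φ x ∂ν + 8 * (t * L) ^ 2 * 2 := by gcongr; exact h.integral_exp_le
    _ ≤ _ := by
        have := Real.add_one_le_exp (t * ∫ x, φ x ∂ν + 16 * (t * L) ^ 2)
        linarith

variable {P : Measure Ω} [IsProbabilityMeasure P] [IsProbabilityMeasure ν] {n : ℕ}
  {X : Fin n → Ω → E}

theorem SubExp.measure_upper_le (h : SubExp φ L ν) (hn : 0 < n) (hX : ∀ i, HasLaw (X i) ν P)
    (hind : iIndepFun X P) {u : ℝ} (hu : 0 ≤ u) :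
    P {ω | ∫ x, φ x ∂ν + 10 * L * (√(u / n) + u / n) ≤ 1 / (n : ℝ) * ∑ i, φ (X i ω)} ≤
      ENNReal.ofReal (Real.exp (-u)) := by
  have hL := h.pos
  have hn' : (0 : ℝ) < n := by exact_mod_cast hn
  set μ := ∫ x, φ x ∂ν with hμ
  set ε := 10 * L * (√(u / n) + u / n) with hε
  have hY : iIndepFun (fun i ω => φ (X i ω)) P :=
    hind.comp₀ (fun _ => φ) (fun i => (hX i).aemeasurable)
      (fun i => by rw [(hX i).map_eq]; exact h.aemeasurable)
  have hYm : ∀ i, AEMeasurable (fun ω => φ (X i ω)) P := fun i =>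
    AEMeasurable.comp_aemeasurable (by rw [(hX i).map_eq]; exact h.aemeasurable) (hX i).aemeasurable
  have hmgf : ∀ i t, mgf (fun ω => φ (X i ω)) P t = mgf φ ν t := by
    intro i t
    rw [← (hX i).map_eq]
    exact (mgf_map (hX i).aemeasurable (by
      rw [(hX i).map_eq]
      exact (Real.measurable_exp.comp_aemeasurable
        (h.aemeasurable.const_mul t)).aestronglyMeasurable)).symm
  have hYi : ∀ i t, |t| ≤ 1 / (2 * L) → Integrable (fun ω => Real.exp (t * φ (X i ω))) P := by
    intro i t ht
    have := h.integrable_exp_mul ht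
    rw [← (hX i).map_eq] at this
    exact this.comp_aemeasurable (hX i).aemeasurable
  have chernoff : ∀ t, 0 ≤ t → t ≤ 1 / (2 * L) →
      P {ω | μ + ε ≤ 1 / (n : ℝ) * ∑ i, φ (X i ω)} ≤
        ENNReal.ofReal (Real.exp (n * (16 * (t * L) ^ 2 - t * ε))) := by
    intro t ht0 ht
    have hat : |t| ≤ 1 / (2 * L) := by rwa [abs_of_nonneg ht0]
    have h2 : mgf (fun ω => ∑ i, φ (X i ω)) P t = mgf φ ν t ^ n := by
      have := hY.mgf_sum₀ (t := t) hYm Finset.univ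
      simp only [hmgf, Finset.prod_const, Finset.card_univ, Fintype.card_fin] at this
      rw [← this]
      congr 1
      ext ω; simp
    have h1 := measure_ge_le_exp_mul_mgf (μ := P) (X := fun ω => ∑ i, φ (X i ω)) (t := t)
      (n * (μ + ε)) ht0 (by
        -- A non-integrable exponential would have `mgf` equal to the default value 0, but here it
        -- is a power of a positive number.
        by_contra hni
        have h0 := mgf_undef hni
        rw [h2] at h0
        exact (pow_pos (mgf_pos (h.integrable_exp_mul hat)) n).ne' h0)
    have h3 : {ω | μ + ε ≤ 1 / (n : ℝ) * ∑ i, φ (X i ω)} =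
        {ω | n * (μ + ε) ≤ ∑ i, φ (X i ω)} := by
      ext ω
      simp only [Set.mem_ofPred_eq]
      rw [one_div, inv_mul_eq_div, le_div_iff₀ hn', mul_comm]
    rw [h3, ← ENNReal.ofReal_toReal (measure_ne_top P _)]
    refine ENNReal.ofReal_le_ofReal (h1.trans ?_)
    rw [h2]
    calc _ ≤ Real.exp (-t * (n * (μ + ε))) * Real.exp (t * μ + 16 * (t * L) ^ 2) ^ n := by
          gcongr
          · exact mgf_nonneg
          · exact h.mgf_le hat
      _ = _ := by
          rw [← Real.exp_nat_mul, ← Real.exp_add]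
          congr 1
          ring
  have hun : 0 ≤ u / n := by positivity
  -- The Chernoff parameter is √(u/n)/(2L) in the Gaussian regime and the largest admissible value
  -- 1/(2L) in the exponential one.
  by_cases hcase : u ≤ n
  · set s := √(u / n) with hs
    have hs0 : 0 ≤ s := Real.sqrt_nonneg _
    have hs2 : s ^ 2 = u / n := Real.sq_sqrt hun
    have hs1 : s ≤ 1 := by
      rw [hs, Real.sqrt_le_one]
      exact (div_le_one hn').2 hcase
    refine (chernoff (s / (2 * L)) (by positivity) (by gcongr)).trans
      (ENNReal.ofReal_le_ofReal (Real.exp_le_exp.2 ?_))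
    have e1 : s / (2 * L) * L = s / 2 := by field_simp
    have e2 : s / (2 * L) * ε = 5 * s * (s + u / n) := by rw [hε]; field_simp; ring
    rw [e1, e2]
    have : n * (16 * (s / 2) ^ 2 - 5 * s * (s + u / n)) ≤ n * (-(s ^ 2)) := by
      gcongr
      have := mul_nonneg hs0 hun
      nlinarith
    rw [hs2] at this
    refine this.trans (le_of_eq ?_)
    field_simp
  · push Not at hcase
    refine (chernoff (1 / (2 * L)) (by positivity) le_rfl).trans
      (ENNReal.ofReal_le_ofReal (Real.exp_le_exp.2 ?_))
    have e1 : 1 / (2 * L) * L = 1 / 2 := by field_simp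
    have e2 : 1 / (2 * L) * ε = 5 * (√(u / n) + u / n) := by rw [hε]; field_simp; ring
    rw [e1, e2]
    have e3 : (n : ℝ) * (u / n) = u := by field_simp
    have e4 : 0 ≤ (n : ℝ) * √(u / n) := by positivity
    nlinarith

theorem SubExp.measure_deviation_le (h : SubExp φ L ν) (hn : 0 < n) (hX : ∀ i, HasLaw (X i) ν P)
    (hind : iIndepFun X P) {u : ℝ} (hu : 0 ≤ u) :
    P {ω | 10 * L * (√(u / n) + u / n) ≤ |1 / (n : ℝ) * ∑ i, φ (X i ω) - ∫ x, φ x ∂ν|} ≤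
      ENNReal.ofReal (2 * Real.exp (-u)) := by
  have h1 := h.measure_upper_le hn hX hind hu
  have h2 := h.neg.measure_upper_le hn hX hind hu
  rw [two_mul, ENNReal.ofReal_add (Real.exp_pos _).le (Real.exp_pos _).le]
  refine le_trans ?_ (add_le_add h1 h2)
  refine (measure_mono fun ω hω => ?_).trans (measure_union_le _ _)
  simp only [Set.mem_ofPred_eq, integral_neg, Finset.sum_neg_distrib, mul_neg, Set.mem_union] at hω ⊢
  rcases le_abs.1 hω with hω | hω
  · left; linarith
  · right; linarith

end Bernstein

/-! ### Integration by parts on the orthant -/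

/-- The boundary term u(T)v(T) converges because the integral of (uv)' does, and its limit must be 0
because uv is integrable. No decay estimate at infinity is needed. -/
theorem integral_Ioi_deriv_mul_add_eq_zero {u v v' : ℝ → ℝ}
    (hu : ∀ T, 0 ≤ T → AbsolutelyContinuousOnInterval u 0 T) (hu0 : u 0 = 0)
    (hv : ContDiff ℝ 1 v) (hv' : ∀ s, HasDerivAt v (v' s) s)
    (hint : IntegrableOn (fun s => deriv u s * v s + u s * v' s) (Set.Ioi 0))
    (huv : IntegrableOn (fun s => u s * v s) (Set.Ioi 0)) :
    ∫ s in Set.Ioi 0, (deriv u s * v s + u s * v' s) = 0 := by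
  have h1 : ∀ T, 0 ≤ T → ∫ s in (0 : ℝ)..T, (deriv u s * v s + u s * v' s) = u T * v T := by
    intro T hT
    have h := (hu T hT).integral_deriv_mul_eq_sub hv.contDiffOn.absolutelyContinuousOnInterval
    rw [hu0, zero_mul, sub_zero] at h
    rw [← h]
    simp only [(hv' _).deriv]
  have h2 := intervalIntegral_tendsto_integral_Ioi 0 hint tendsto_id
  have h3 : Tendsto (fun T => u T * v T) atTop
      (𝓝 (∫ s in Set.Ioi 0, (deriv u s * v s + u s * v' s))) := by
    refine h2.congr' ?_
    filter_upwards [eventually_ge_atTop 0] with T hT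
    exact h1 T hT
  refine IntegrableAtFilter.eq_zero_of_tendsto ⟨_, Ioi_mem_atTop 0, huv⟩ ?_ h3
  intro s hs
  rcases mem_atTop_sets.1 hs with ⟨b, hb⟩
  rw [← top_le_iff, ← Real.volume_Ici (a := b)]
  exact measure_mono hb

/-! ### Bounded weights and the sub-exponential scales of the entries of Γ and g -/

section Weights

variable {m : ℕ} {K : Matrix (Fin m) (Fin m) ℝ} {h : Fin m → ℝ → ℝ} {M M' : ℝ}

/-- The almost everywhere bounds `0 ≤ h_j ≤ M` and `0 ≤ h_j' ≤ M'` for weights in `𝓗_{1,1}`. -/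
structure BoundedWeights (h : Fin m → ℝ → ℝ) (M M' : ℝ) : Prop where
  memH : MemH 1 1 h
  bound : ∀ j, ∀ᵐ x ∂(volume.restrict (Set.Ioi (0 : ℝ))), 0 ≤ h j x ∧ h j x ≤ M
  deriv_bound : ∀ j, ∀ᵐ x ∂(volume.restrict (Set.Ioi (0 : ℝ))), 0 ≤ deriv (h j) x ∧ deriv (h j) x ≤ M'

theorem ae_restrict_Ioi_exists {p : ℝ → Prop} (hp : ∀ᵐ x ∂(volume.restrict (Set.Ioi (0 : ℝ))), p x) :
    ∃ x, p x := by
  have : NeZero (volume.restrict (Set.Ioi (0 : ℝ))) := ⟨by simp⟩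
  exact hp.exists

theorem BoundedWeights.M_pos (H : BoundedWeights h M M') (j : Fin m) : 0 < M := by
  obtain ⟨x, hx⟩ := ae_restrict_Ioi_exists ((H.bound j).and (H.memH.pos j))
  linarith [hx.1.2, hx.2]

theorem BoundedWeights.M'_nonneg (H : BoundedWeights h M M') (j : Fin m) : 0 ≤ M' := by
  obtain ⟨x, hx⟩ := ae_restrict_Ioi_exists (H.deriv_bound j)
  linarith [hx.1, hx.2]

theorem MemH.continuousOn (H : MemH 1 1 h) (j : Fin m) : ContinuousOn (h j) (Set.Ici 0) := by
  intro x hx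
  have hx' : (0 : ℝ) ≤ x := hx
  have h1 : ContinuousOn (h j) (Set.Icc 0 (x + 1)) := by
    have := (H.absCont j 0 (x + 1) le_rfl (by linarith)).continuousOn
    rwa [Set.uIcc_of_le (by linarith)] at this
  refine (h1 x ⟨hx', by linarith⟩).mono_of_mem_nhdsWithin ?_
  rw [← Set.Ici_inter_Iic]
  exact inter_mem_nhdsWithin _ (Iic_mem_nhds (by linarith))

theorem MemH.map_zero (H : MemH 1 1 h) (j : Fin m) : h j 0 = 0 := by
  have h1 : Tendsto (h j) (𝓝[>] 0) (𝓝 (h j 0)) :=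
    (H.continuousOn j 0 Set.self_mem_Ici).mono_left (nhdsWithin_mono _ Set.Ioi_subset_Ici_self)
  have h2 := H.lim_zero j
  simp only [sub_self, max_self, Real.rpow_zero, div_one] at h2
  exact tendsto_nhds_unique h1 h2

theorem MemH.aemeasurable (H : MemH 1 1 h) (j : Fin m) :
    AEMeasurable (fun x : Fin m → ℝ => h j (x j)) (truncNormal 0 K) := by
  refine AEMeasurable.mono_ac ?_ truncNormal_absolutelyContinuous
  refine ContinuousOn.aemeasurable ?_ measurableSet_orthant
  exact (H.continuousOn j).comp (continuous_apply j).continuousOn fun x hx => hx j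

theorem BoundedWeights.ae (H : BoundedWeights h M M') :
    ∀ᵐ x ∂(truncNormal 0 K), ∀ j, 0 < x j ∧ 0 < h j (x j) ∧ h j (x j) ≤ M ∧
      0 ≤ deriv (h j) (x j) ∧ deriv (h j) (x j) ≤ M' := by
  rw [ae_all_iff]
  intro j
  filter_upwards [ae_truncNormal_pos, ae_truncNormal_of_ae_Ioi (H.bound j) j,
    ae_truncNormal_of_ae_Ioi (H.deriv_bound j) j, ae_truncNormal_of_ae_Ioi (H.memH.pos j) j]
    with x h1 h2 h3 h4
  exact ⟨h1 j, h4, h2.2, h3.1, h3.2⟩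

/-- An entry is at most M(x_k² + x_l²)/2, so convexity of exp reduces to the squared exponential
moments of single coordinates. -/
theorem BoundedWeights.subExp_gammaTerm (H : BoundedWeights h M M') (hK : K.PosDef)
    (p q : Fin m × Fin m) :
    SubExp (fun x => gammaTerm h x p q) (32 * M * cX K ^ 2) (truncNormal 0 K) := by
  have := isProbabilityMeasure_truncNormal hK
  have hc := cX_pos hK p.1
  have hM := H.M_pos p.1
  refine ⟨?_, by positivity, ?_⟩
  · unfold gammaTerm
    split_ifs
    · exact ((H.memH.aemeasurable p.2).mul (measurable_pi_apply _).aemeasurable).mul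
        (measurable_pi_apply _).aemeasurable
    · exact aemeasurable_const
  · have hb : ∀ᵐ x ∂(truncNormal 0 K),
        ENNReal.ofReal (Real.exp (|gammaTerm h x p q| / (32 * M * cX K ^ 2))) ≤
        2⁻¹ * ENNReal.ofReal (Real.exp (x p.1 ^ 2 / (32 * cX K ^ 2))) +
        2⁻¹ * ENNReal.ofReal (Real.exp (x q.1 ^ 2 / (32 * cX K ^ 2))) := by
      filter_upwards [H.ae (K := K)] with x hx
      have e1 : (2⁻¹ : ENNReal) = ENNReal.ofReal (1 / 2) := by
        rw [one_div, ENNReal.ofReal_inv_of_pos (by norm_num)]; simp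
      rw [e1, ← ENNReal.ofReal_mul (by norm_num), ← ENNReal.ofReal_mul (by norm_num),
        ← ENNReal.ofReal_add (by positivity) (by positivity)]
      refine ENNReal.ofReal_le_ofReal ?_
      have hx1 := (hx p.1).1
      have hx2 := (hx q.1).1
      have h1 : |gammaTerm h x p q| ≤ M * ((x p.1 ^ 2 + x q.1 ^ 2) / 2) := by
        unfold gammaTerm
        split_ifs
        · have h3 := (hx p.2).2.1
          rw [abs_of_nonneg (by positivity), mul_assoc]
          have : x p.1 * x q.1 ≤ (x p.1 ^ 2 + x q.1 ^ 2) / 2 := by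
            nlinarith [sq_nonneg (x p.1 - x q.1)]
          exact mul_le_mul (hx p.2).2.2.1 this (by positivity) hM.le
        · rw [abs_zero]; positivity
      have h2 : |gammaTerm h x p q| / (32 * M * cX K ^ 2) ≤
          x p.1 ^ 2 / (32 * cX K ^ 2) / 2 + x q.1 ^ 2 / (32 * cX K ^ 2) / 2 := by
        calc _ ≤ M * ((x p.1 ^ 2 + x q.1 ^ 2) / 2) / (32 * M * cX K ^ 2) := by gcongr
          _ = _ := by field_simp
      have h3 : Real.exp (1 / 2 * (x p.1 ^ 2 / (32 * cX K ^ 2)) +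
          1 / 2 * (x q.1 ^ 2 / (32 * cX K ^ 2))) ≤
          1 / 2 * Real.exp (x p.1 ^ 2 / (32 * cX K ^ 2)) +
          1 / 2 * Real.exp (x q.1 ^ 2 / (32 * cX K ^ 2)) :=
        convexOn_exp.2 (Set.mem_univ _) (Set.mem_univ _) (by norm_num) (by norm_num) (by norm_num)
      refine le_trans (Real.exp_le_exp.2 (h2.trans (le_of_eq ?_))) h3
      ring
    refine (lintegral_mono_ae hb).trans ?_
    rw [lintegral_add_left (by fun_prop), lintegral_const_mul _ (by fun_prop),
      lintegral_const_mul _ (by fun_prop)]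
    calc _ ≤ 2⁻¹ * 2 + 2⁻¹ * 2 := by
          gcongr
          · exact lintegral_exp_sq_le_two hK _
          · exact lintegral_exp_sq_le_two hK _
      _ = (2 : ENNReal) := by
        rw [ENNReal.inv_mul_cancel (by simp) (by simp)]; norm_num

/-- An entry is at most M + M'x_k, so the linear exponential moment suffices; the factor 4 keeps the
total exponent below 1/2, and √e ≤ 2. -/
theorem BoundedWeights.subExp_gTerm (H : BoundedWeights h M M') (hK : K.PosDef)
    (p : Fin m × Fin m) :
    SubExp (fun x => gTerm h x p) (4 * (M' * cX K + M)) (truncNormal 0 K) := by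
  have := isProbabilityMeasure_truncNormal hK
  have hc := cX_pos hK p.1
  have hM := H.M_pos p.1
  have hM' := H.M'_nonneg p.1
  have hL : 0 < M' * cX K + M := by positivity
  refine ⟨?_, by positivity, ?_⟩
  · unfold gTerm
    refine AEMeasurable.add (AEMeasurable.mul ?_ (measurable_pi_apply _).aemeasurable) ?_
    · exact ((measurable_deriv (h p.2)).comp (measurable_pi_apply p.2)).aemeasurable
    · split_ifs
      · exact H.memH.aemeasurable p.2
      · exact aemeasurable_const
  · set L := 4 * (M' * cX K + M) with hLdef
    have hb : ∀ᵐ x ∂(truncNormal 0 K), ENNReal.ofReal (Real.exp (|gTerm h x p| / L)) ≤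
        ENNReal.ofReal (Real.exp (M / L) * Real.exp (M' / L * x p.1)) := by
      filter_upwards [H.ae (K := K)] with x hx
      refine ENNReal.ofReal_le_ofReal ?_
      rw [← Real.exp_add, Real.exp_le_exp]
      have hx1 := (hx p.1).1
      have hx2 := hx p.2
      have h1 : |gTerm h x p| ≤ M + M' * x p.1 := by
        unfold gTerm
        have h3 : 0 ≤ deriv (h p.2) (x p.2) * x p.1 := mul_nonneg hx2.2.2.2.1 hx1.le
        have h4 : deriv (h p.2) (x p.2) * x p.1 ≤ M' * x p.1 := by
          gcongr; exact hx2.2.2.2.2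
        split_ifs
        · rw [abs_of_nonneg (by linarith [hx2.2.1])]
          linarith [hx2.2.2.1]
        · rw [add_zero, abs_of_nonneg h3]; linarith
      calc _ ≤ (M + M' * x p.1) / L := by gcongr
        _ = _ := by ring
    refine (lintegral_mono_ae hb).trans ?_
    rw [← ofReal_integral_eq_lintegral_ofReal
      ((integrable_exp_truncNormal hK (M' / L) p.1).const_mul _)
      (Eventually.of_forall fun x => by positivity), integral_const_mul]
    rw [show (2 : ENNReal) = ENNReal.ofReal 2 by simp]
    refine ENNReal.ofReal_le_ofReal ?_
    have h1 := integral_exp_le_cX hK (a := M' / L) (by positivity) p.1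
    have h2 : M / L ≤ 1 / 4 := by
      rw [div_le_div_iff₀ (by positivity) (by norm_num), hLdef]
      nlinarith [mul_nonneg hM' hc.le]
    have h3 : M' / L * cX K ≤ 1 / 4 := by
      rw [div_mul_eq_mul_div, div_le_div_iff₀ (by positivity) (by norm_num), hLdef]
      linarith
    have h4 : 0 ≤ M' / L * cX K := by positivity
    calc _ ≤ Real.exp (M / L) * Real.exp (M' / L * cX K / 2 + (M' / L) ^ 2 * cX K ^ 2 / 16) := by
          gcongr
      _ = Real.exp (M / L + (M' / L * cX K / 2 + (M' / L * cX K) ^ 2 / 16)) := by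
          rw [← Real.exp_add, mul_pow]
      _ ≤ Real.exp (1 / 2) := by
          rw [Real.exp_le_exp]
          nlinarith
      _ ≤ 2 := by
          have h5 := Real.exp_one_lt_d9
          have h6 : Real.exp (1 / 2) ^ 2 = Real.exp 1 := by
            rw [← Real.exp_nat_mul]; norm_num
          have h7 := Real.exp_pos (1 / 2)
          nlinarith

theorem BoundedWeights.integrable_coord_mul (H : BoundedWeights h M M') (hK : K.PosDef)
    (j k : Fin m) : Integrable (fun x => h j (x j) * x k) (truncNormal 0 K) := by
  refine ((integrable_coord_truncNormal hK k).const_mul M).mono'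
    ((H.memH.aemeasurable j).mul (measurable_pi_apply k).aemeasurable).aestronglyMeasurable ?_
  filter_upwards [H.ae (K := K)] with x hx
  have h1 := (hx k).1
  have h2 := (hx j).2.1
  rw [Real.norm_of_nonneg (by positivity)]
  gcongr
  exact (hx j).2.2.1

theorem sum_gammaTerm_mul_vec (hK : K.PosDef) (x : Fin m → ℝ) (k j : Fin m) :
    ∑ q, gammaTerm h x (k, j) q * vec K q = h j (x j) * x k * (K *ᵥ x) j := by
  rw [Fintype.sum_prod_type]
  simp only [gammaTerm, vec, ite_mul, zero_mul, Finset.sum_ite_eq, Finset.mem_univ, if_true]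
  rw [Matrix.mulVec, dotProduct, Finset.mul_sum]
  refine Finset.sum_congr rfl fun l _ => ?_
  have : K j l = K l j := by simpa using hK.isHermitian.apply l j
  rw [this]; ring

end Weights

/-! ### Reduction of the orthant identity to coordinate lines -/

section Fubini

variable {m : ℕ} {K : Matrix (Fin (m + 1)) (Fin (m + 1)) ℝ} {h : Fin (m + 1) → ℝ → ℝ} {M M' : ℝ}

theorem insertNth_eq_add_smul (j : Fin (m + 1)) (s : ℝ) (y : Fin m → ℝ) :
    (j.insertNth s y : Fin (m + 1) → ℝ) = j.insertNth 0 y + s • Pi.single j 1 := by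
  ext k
  refine Fin.succAboveCases j ?_ (fun i => ?_) k
  · simp
  · simp

theorem quadForm_insertNth (hK : K.PosDef) (j : Fin (m + 1)) (s : ℝ) (y : Fin m → ℝ)
    {b : Fin (m + 1) → ℝ} (hb : b = j.insertNth 0 y) :
    (j.insertNth s y : Fin (m + 1) → ℝ) ⬝ᵥ (K *ᵥ j.insertNth s y) =
      b ⬝ᵥ (K *ᵥ b) + 2 * s * (K *ᵥ b) j + s ^ 2 * K j j := by
  have hKt : Kᵀ = K := by
    have := hK.isHermitian.eq
    simpa only [Matrix.conjTranspose_eq_transpose_of_trivial] using this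
  have h1 : b ⬝ᵥ (K *ᵥ Pi.single j 1) = (K *ᵥ b) j := by
    rw [Matrix.dotProduct_mulVec, ← Matrix.mulVec_transpose, hKt, dotProduct_single, mul_one]
  have h2 : (K *ᵥ Pi.single j 1) j = K j j := by simp
  rw [insertNth_eq_add_smul, ← hb, Matrix.mulVec_add, Matrix.mulVec_smul, dotProduct_add,
    add_dotProduct, add_dotProduct, smul_dotProduct, dotProduct_smul, smul_dotProduct,
    dotProduct_smul, h1, single_dotProduct, single_dotProduct, h2]
  simp only [smul_eq_mul]
  ring

theorem mulVec_insertNth (j : Fin (m + 1)) (s : ℝ) (y : Fin m → ℝ) {b : Fin (m + 1) → ℝ}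
    (hb : b = j.insertNth 0 y) :
    (K *ᵥ (j.insertNth s y : Fin (m + 1) → ℝ)) j = (K *ᵥ b) j + s * K j j := by
  rw [insertNth_eq_add_smul, ← hb, Matrix.mulVec_add, Matrix.mulVec_smul]
  simp

/-- On a line in direction j the integrand is the derivative of h_j(s) v(s), where v is the k-th
coordinate times the Gaussian weight. The indicator of k = j in g is the slope of that coordinate.
-/
theorem integral_section_eq_zero (H : MemH 1 1 h) (hK : K.PosDef) (j k : Fin (m + 1))
    (y : Fin m → ℝ)
    (h1 : IntegrableOn (fun s : ℝ => (gTerm h (j.insertNth s y) (k, j) -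
      h j s * (j.insertNth s y : Fin (m + 1) → ℝ) k * (K *ᵥ (j.insertNth s y)) j) *
        gaussWeight K (j.insertNth s y)) (Set.Ioi 0))
    (h2 : IntegrableOn (fun s : ℝ => h j s * (j.insertNth s y : Fin (m + 1) → ℝ) k *
      gaussWeight K (j.insertNth s y)) (Set.Ioi 0)) :
    ∫ s in Set.Ioi (0 : ℝ), (gTerm h (j.insertNth s y) (k, j) -
      h j s * (j.insertNth s y : Fin (m + 1) → ℝ) k * (K *ᵥ (j.insertNth s y)) j) *
        gaussWeight K (j.insertNth s y) = 0 := by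
  set b : Fin (m + 1) → ℝ := j.insertNth 0 y with hb
  set e : ℝ := if k = j then 1 else 0 with he
  set w : ℝ → ℝ := fun s => Real.exp (-(1 / 2) *
    (b ⬝ᵥ (K *ᵥ b) + 2 * s * (K *ᵥ b) j + s ^ 2 * K j j)) with hw
  have hgw : ∀ s, gaussWeight K (j.insertNth s y) = w s := fun s => by
    rw [gaussWeight, quadForm_insertNth hK j s y hb]
  have hxk : ∀ s : ℝ, (j.insertNth s y : Fin (m + 1) → ℝ) k = b k + s * e := fun s => by
    rw [insertNth_eq_add_smul, ← hb, he]
    simp [Pi.single_apply]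
  set v : ℝ → ℝ := fun s => (b k + s * e) * w s with hv
  set v' : ℝ → ℝ := fun s => e * w s - (b k + s * e) * ((K *ᵥ b) j + s * K j j) * w s with hv'
  have hderiv : ∀ s, HasDerivAt v (v' s) s := by
    intro s
    have d1 : HasDerivAt (fun s : ℝ => b k + s * e) e s := by
      simpa using ((hasDerivAt_id s).mul_const e).const_add (b k)
    have d2 : HasDerivAt (fun s : ℝ => -(1 / 2) *
        (b ⬝ᵥ (K *ᵥ b) + 2 * s * (K *ᵥ b) j + s ^ 2 * K j j)) (-((K *ᵥ b) j + s * K j j)) s := by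
      have d3 := (((((hasDerivAt_id s).const_mul 2).mul_const ((K *ᵥ b) j)).const_add
        (b ⬝ᵥ (K *ᵥ b))).add (((hasDerivAt_id s).pow 2).mul_const (K j j))).const_mul (-(1 / 2))
      refine d3.congr_deriv ?_
      simp only [id, Nat.cast_ofNat]
      ring
    have d4 := d1.mul d2.exp
    refine d4.congr_deriv ?_
    simp only [hv', hw]
    ring
  have hcd : ContDiff ℝ 1 v := by
    simp only [hv, hw]
    fun_prop
  have e1 : ∀ s : ℝ, (gTerm h (j.insertNth s y) (k, j) -
      h j s * (j.insertNth s y : Fin (m + 1) → ℝ) k * (K *ᵥ (j.insertNth s y)) j) *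
        gaussWeight K (j.insertNth s y) = deriv (h j) s * v s + h j s * v' s := by
    intro s
    rw [hgw, mulVec_insertNth j s y hb, gTerm, hxk]
    simp only [Fin.insertNth_apply_same, hv, hv', he]
    split_ifs <;> ring
  have e2 : ∀ s : ℝ, h j s * (j.insertNth s y : Fin (m + 1) → ℝ) k *
      gaussWeight K (j.insertNth s y) = h j s * v s := by
    intro s
    rw [hgw, hxk]
    simp only [hv]; ring
  simp only [e1] at h1 ⊢
  simp only [e2] at h2
  exact integral_Ioi_deriv_mul_add_eq_zero (fun T hT => H.absCont j 0 T le_rfl hT)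
    (H.map_zero j) hcd hderiv h1 h2

/-- Sections of integrable functions are integrable only almost everywhere, so vanishing is asked
only on good lines. The auxiliary G carries the integrability that kills the boundary term at
infinity. -/
theorem setIntegral_orthant_eq_zero_of_section {F G : (Fin (m + 1) → ℝ) → ℝ} (j : Fin (m + 1))
    (hF : IntegrableOn F (orthant (m + 1))) (hG : IntegrableOn G (orthant (m + 1)))
    (hFG : ∀ y : Fin m → ℝ, IntegrableOn (fun s : ℝ => F (j.insertNth s y)) (Set.Ioi 0) →
      IntegrableOn (fun s : ℝ => G (j.insertNth s y)) (Set.Ioi 0) →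
      ∫ s in Set.Ioi (0 : ℝ), F (j.insertNth s y) = 0) :
    ∫ x in orthant (m + 1), F x = 0 := by
  set e := (MeasurableEquiv.piFinSuccAbove (fun _ : Fin (m + 1) => ℝ) j).symm with he
  have hpres : MeasurePreserving e volume volume :=
    (volume_preserving_piFinSuccAbove (fun _ : Fin (m + 1) => ℝ) j).symm
  have hpre : e ⁻¹' (orthant (m + 1)) = Set.Ici 0 ×ˢ orthant m := by
    ext ⟨s, y⟩
    have : e (s, y) = j.insertNth s y := rfl
    simp only [Set.mem_preimage, this, orthant, Set.mem_ofPred_eq, Set.mem_prod, Set.mem_Ici]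
    constructor
    · intro hx
      exact ⟨by simpa using hx j, fun i => by simpa using hx (j.succAbove i)⟩
    · rintro ⟨hs, hy⟩ i
      refine Fin.succAboveCases j ?_ (fun i => ?_) i
      · simpa using hs
      · simpa using hy i
  have hint : ∀ F : (Fin (m + 1) → ℝ) → ℝ, IntegrableOn F (orthant (m + 1)) →
      Integrable (F ∘ e) ((volume.restrict (Set.Ici 0)).prod (volume.restrict (orthant m))) := by
    intro F hF
    rw [← hpres.integrableOn_comp_preimage e.measurableEmbedding, hpre] at hF
    rwa [Measure.prod_restrict]
  rw [← hpres.setIntegral_preimage_emb e.measurableEmbedding, hpre, Measure.volume_eq_prod,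
    ← Measure.prod_restrict, integral_prod_symm (fun z => F (e z)) (hint F hF)]
  refine integral_eq_zero_of_ae ?_
  filter_upwards [(hint F hF).prod_left_ae, (hint G hG).prod_left_ae] with y h1 h2
  rw [Pi.zero_apply, integral_Ici_eq_integral_Ioi]
  exact hFG y (IntegrableOn.mono_set h1 Set.Ioi_subset_Ici_self)
    (IntegrableOn.mono_set h2 Set.Ioi_subset_Ici_self)

end Fubini

/-- This is the score matching identity: K is a stationary point of the unregularized population
loss. -/
theorem BoundedWeights.popGamma_mulVec {m : ℕ} {K : Matrix (Fin m) (Fin m) ℝ}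
    {h : Fin m → ℝ → ℝ} {M M' : ℝ} (H : BoundedWeights h M M') (hK : K.PosDef)
    (p : Fin m × Fin m) :
    (popGamma h (truncNormal 0 K) *ᵥ vec K) p = ∫ x, gTerm h x p ∂(truncNormal 0 K) := by
  obtain ⟨k, j⟩ := p
  have hg := (H.subExp_gTerm hK (k, j)).integrable
  have hΓ : ∀ q, Integrable (fun x => gammaTerm h x (k, j) q * vec K q) (truncNormal 0 K) :=
    fun q => (H.subExp_gammaTerm hK (k, j) q).integrable.mul_const _
  have hΓs : Integrable (fun x => h j (x j) * x k * (K *ᵥ x) j) (truncNormal 0 K) := by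
    have := integrable_finsetSum Finset.univ fun q _ => hΓ q
    simpa only [sum_gammaTerm_mul_vec hK] using this
  have h1 : (popGamma h (truncNormal 0 K) *ᵥ vec K) (k, j) =
      ∫ x, h j (x j) * x k * (K *ᵥ x) j ∂(truncNormal 0 K) := by
    simp only [← sum_gammaTerm_mul_vec hK]
    rw [integral_finsetSum _ fun q _ => hΓ q]
    simp only [integral_mul_const]
    rfl
  rw [h1, eq_comm, ← sub_eq_zero, ← integral_sub hg hΓs, integral_truncNormal]
  refine mul_eq_zero_of_right _ ?_
  obtain ⟨m, rfl⟩ : ∃ m', m = m' + 1 := ⟨m - 1, by have := j.pos; omega⟩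
  refine setIntegral_orthant_eq_zero_of_section j
    ((integrable_truncNormal_iff hK).1 (hg.sub hΓs))
    ((integrable_truncNormal_iff hK).1 (H.integrable_coord_mul hK j k)) fun y h2 h3 => ?_
  simp only [Fin.insertNth_apply_same] at h2 h3 ⊢
  exact integral_section_eq_zero H.memH hK j k y h2 h3

/-! ### Deterministic analysis of `ℓ₁`-regularized quadratic losses -/

section Lasso

variable {ι : Type*} [Fintype ι] {A : Matrix ι ι ℝ} {g : ι → ℝ} {lam : ℝ}

/-- The `ℓ₁`-regularized quadratic loss. -/
noncomputable def lassoLoss (A : Matrix ι ι ℝ) (g : ι → ℝ) (lam : ℝ) (v : ι → ℝ) : ℝ :=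
  (1 / 2) * (v ⬝ᵥ (A *ᵥ v)) - g ⬝ᵥ v + lam * ∑ p, |v p|

theorem lassoLoss_add (hA : Aᵀ = A) (v u : ι → ℝ) :
    lassoLoss A g lam (v + u) - lassoLoss A g lam v =
      ∑ p, (u p * ((A *ᵥ v) p - g p) + lam * (|v p + u p| - |v p|)) +
        (1 / 2) * (u ⬝ᵥ (A *ᵥ u)) := by
  have h1 : v ⬝ᵥ (A *ᵥ u) = u ⬝ᵥ (A *ᵥ v) := by
    rw [Matrix.dotProduct_mulVec, ← Matrix.mulVec_transpose, hA, dotProduct_comm]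
  have h2 : ∑ p, (u p * ((A *ᵥ v) p - g p) + lam * (|v p + u p| - |v p|)) =
      u ⬝ᵥ (A *ᵥ v) - g ⬝ᵥ u + lam * (∑ p, |v p + u p| - ∑ p, |v p|) := by
    rw [Finset.sum_add_distrib, ← Finset.mul_sum, Finset.sum_sub_distrib]
    congr 1
    simp only [mul_sub, Finset.sum_sub_distrib, dotProduct, mul_comm]
  rw [h2, lassoLoss, lassoLoss, Matrix.mulVec_add, dotProduct_add, dotProduct_add, add_dotProduct,
    add_dotProduct, h1]
  simp only [Pi.add_apply]
  ring

theorem exists_isMinOn_lassoLoss (hA : ∀ x, x ≠ 0 → 0 < x ⬝ᵥ (A *ᵥ x)) (hlam : 0 ≤ lam)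
    (S : Finset ι) :
    ∃ v : ι → ℝ, (∀ p ∉ S, v p = 0) ∧
      ∀ u : ι → ℝ, (∀ p ∉ S, u p = 0) → lassoLoss A g lam v ≤ lassoLoss A g lam u := by
  obtain ⟨c, hc, hQ⟩ := exists_quadForm_lower_bound hA
  set T : Set (ι → ℝ) := {v | ∀ p ∉ S, v p = 0} with hT
  have hcl : IsClosed T := by
    have : T = ⋂ p, ⋂ (_ : p ∉ S), {v | v p = 0} := by ext; simp [hT]
    rw [this]
    exact isClosed_iInter fun p => isClosed_iInter fun _ =>
      isClosed_eq (continuous_apply p) continuous_const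
  have hcont : Continuous (lassoLoss A g lam) := by
    unfold lassoLoss
    fun_prop
  have hlow : ∀ x : ι → ℝ, c / 4 * ‖x‖ ^ 2 - (∑ p, g p ^ 2) / c ≤ lassoLoss A g lam x := by
    intro x
    have h1 : g ⬝ᵥ x ≤ (∑ p, g p ^ 2) / c + c / 4 * ∑ p, x p ^ 2 := by
      rw [Finset.mul_sum, Finset.sum_div, ← Finset.sum_add_distrib]
      refine Finset.sum_le_sum fun p _ => ?_
      have h : 0 ≤ (g p / c - x p / 2) ^ 2 * c := by positivity
      have e : (g p / c - x p / 2) ^ 2 * c = g p ^ 2 / c + c / 4 * x p ^ 2 - g p * x p := by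
        field_simp; ring
      linarith
    have h2 : ‖x‖ ^ 2 ≤ ∑ p, x p ^ 2 := by
      have h0 : 0 ≤ ∑ p, x p ^ 2 := Finset.sum_nonneg fun _ _ => sq_nonneg _
      rw [← Real.sqrt_le_sqrt_iff h0, Real.sqrt_sq (norm_nonneg _)]
      refine (pi_norm_le_iff_of_nonneg (Real.sqrt_nonneg _)).2 fun p => ?_
      refine Real.abs_le_sqrt ?_
      exact Finset.single_le_sum (f := fun p => x p ^ 2) (fun _ _ => sq_nonneg _)
        (Finset.mem_univ p)
    have h3 : 0 ≤ lam * ∑ p, |x p| := mul_nonneg hlam (Finset.sum_nonneg fun _ _ => abs_nonneg _)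
    have h4 := hQ x
    have h5 : c / 4 * ‖x‖ ^ 2 ≤ c / 4 * ∑ p, x p ^ 2 := by gcongr
    unfold lassoLoss
    linarith
  have hev : ∀ᶠ x in cocompact (ι → ℝ) ⊓ 𝓟 T, lassoLoss A g lam 0 ≤ lassoLoss A g lam x := by
    have h0 : lassoLoss A g lam 0 = 0 := by simp [lassoLoss]
    rw [h0]
    have h1 : Tendsto (fun x : ι → ℝ => c / 4 * ‖x‖ ^ 2 - (∑ p, g p ^ 2) / c)
        (cocompact (ι → ℝ)) atTop := by
      refine tendsto_atTop_add_const_right _ _ (Tendsto.const_mul_atTop (by positivity) ?_)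
      exact (tendsto_pow_atTop (by norm_num)).comp (tendsto_norm_cocompact_atTop)
    filter_upwards [mem_inf_of_left (h1.eventually_ge_atTop 0)] with x hx
    exact le_trans hx (hlow x)
  obtain ⟨v, hv, hmin⟩ := hcont.continuousOn.exists_isMinOn' hcl
    (show (0 : ι → ℝ) ∈ T from fun _ _ => rfl) hev
  exact ⟨v, hv, fun u hu => hmin hu⟩

/-- The conclusion says that minus the p-th partial derivative of the quadratic part lies in
λ∂|·|(v_p), written as a variational inequality. Perturb by εt, use convexity of the absolute value,
divide by ε and let the quadratic term vanish. -/
theorem first_order_of_isMinOn [DecidableEq ι] (hA : Aᵀ = A) (hlam : 0 ≤ lam) {S : Finset ι}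
    {v : ι → ℝ} (hv : ∀ p ∉ S, v p = 0)
    (hmin : ∀ u : ι → ℝ, (∀ p ∉ S, u p = 0) → lassoLoss A g lam v ≤ lassoLoss A g lam u)
    {p : ι} (hp : p ∈ S) (t : ℝ) :
    0 ≤ t * ((A *ᵥ v) p - g p) + lam * (|v p + t| - |v p|) := by
  set G := (A *ᵥ v) p - g p with hG
  have h1 : ∀ t : ℝ, 0 ≤ t * G + lam * (|v p + t| - |v p|) + 1 / 2 * (t ^ 2 * A p p) := by
    intro t
    have h := hmin (v + Pi.single p t) (fun q hq => by
      have : q ≠ p := fun h => hq (h ▸ hp)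
      simp [hv q hq, this])
    rw [← sub_nonneg, lassoLoss_add hA, Finset.sum_eq_single p] at h
    · rw [single_dotProduct] at h
      simp only [Pi.single_eq_same, Matrix.mulVec_single, op_smul_eq_mul,
        Pi.smul_apply, Matrix.col_apply] at h
      rw [hG]
      linarith
    · intro q _ hq
      simp [hq]
    · simp
  by_contra hneg
  push Not at hneg
  set N := t * G + lam * (|v p + t| - |v p|) with hN
  have h2 : ∀ ε : ℝ, 0 < ε → ε ≤ 1 → 0 ≤ N + ε * (1 / 2 * (t ^ 2 * A p p)) := by
    intro ε hε hε1
    have h3 := h1 (ε * t)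
    have h4 : |v p + ε * t| ≤ (1 - ε) * |v p| + ε * |v p + t| := by
      calc |v p + ε * t| = |(1 - ε) * v p + ε * (v p + t)| := by ring_nf
        _ ≤ |(1 - ε) * v p| + |ε * (v p + t)| := abs_add_le _ _
        _ = _ := by rw [abs_mul, abs_mul, abs_of_nonneg (by linarith : 0 ≤ 1 - ε), abs_of_pos hε]
    have h5 := mul_le_mul_of_nonneg_left h4 hlam
    have h6 : 0 ≤ ε * (N + ε * (1 / 2 * (t ^ 2 * A p p))) := by
      rw [hN]; nlinarith
    exact nonneg_of_mul_nonneg_right h6 hε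
  set B := 1 / 2 * (t ^ 2 * A p p) with hB
  -- This ε makes the quadratic correction at most -N/2, contradicting N < 0.
  have h7 := h2 (min 1 (-N / (2 * (|B| + 1)))) (lt_min one_pos (by
    have : 0 < |B| + 1 := by positivity
    apply div_pos <;> linarith)) (min_le_left _ _)
  have h8 : min 1 (-N / (2 * (|B| + 1))) * B ≤ (-N / (2 * (|B| + 1))) * (|B| + 1) := by
    have e1 : min 1 (-N / (2 * (|B| + 1))) ≤ -N / (2 * (|B| + 1)) := min_le_right _ _
    have e2 : B ≤ |B| + 1 := by linarith [le_abs_self B]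
    have e3 : 0 ≤ -N / (2 * (|B| + 1)) := by
      apply div_nonneg <;> [linarith; positivity]
    have e4 : 0 ≤ min 1 (-N / (2 * (|B| + 1))) := le_min zero_le_one e3
    exact (mul_le_mul_of_nonneg_left e2 e4).trans
      (mul_le_mul_of_nonneg_right e1 (by positivity))
  have h9 : (-N / (2 * (|B| + 1))) * (|B| + 1) = -N / 2 := by
    have : |B| + 1 ≠ 0 := by positivity
    field_simp
  linarith

theorem abs_gradient_le_of_first_order (hlam : 0 ≤ lam) {G a : ℝ}
    (h : ∀ t : ℝ, 0 ≤ t * G + lam * (|a + t| - |a|)) : |G| ≤ lam := by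
  have key : ∀ t, lam * (|a + t| - |a|) ≤ lam * |t| := fun t => by
    gcongr
    linarith [abs_add_le a t]
  rw [_root_.abs_le]
  constructor
  · have := h 1
    have h1 := key 1
    simp only [abs_one] at h1
    linarith
  · have := h (-1)
    have h1 := key (-1)
    simp only [abs_neg, abs_one] at h1
    linarith

/-- The non-quadratic part of the increment separates over coordinates, so coordinatewise conditions
give global optimality. The retained quadratic gap later yields uniqueness. -/
theorem lassoLoss_add_le_of_first_order (hA : Aᵀ = A) {v : ι → ℝ}
    (h : ∀ p (t : ℝ), 0 ≤ t * ((A *ᵥ v) p - g p) + lam * (|v p + t| - |v p|)) (u : ι → ℝ) :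
    lassoLoss A g lam v + (1 / 2) * ((u - v) ⬝ᵥ (A *ᵥ (u - v))) ≤ lassoLoss A g lam u := by
  have h1 := lassoLoss_add (g := g) (lam := lam) hA v (u - v)
  rw [add_sub_cancel] at h1
  have h2 : 0 ≤ ∑ p, ((u - v) p * ((A *ᵥ v) p - g p) + lam * (|v p + (u - v) p| - |v p|)) :=
    Finset.sum_nonneg fun p _ => h p _
  linarith

end Lasso

/-! ### The primal-dual witness argument -/

section PrimalDualWitness

variable {ι : Type*} [Fintype ι]

theorem rowSum_le_rowSumNorm {κ μ : Type*} [Fintype κ] [Fintype μ] (B : Matrix κ μ ℝ) (i : κ) :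
    ∑ j, |B i j| ≤ rowSumNorm B :=
  le_ciSup (f := fun i => ∑ j, |B i j|) (Set.finite_range _).bddAbove i

theorem rowSumNorm_nonneg {κ μ : Type*} [Fintype μ] (B : Matrix κ μ ℝ) : 0 ≤ rowSumNorm B :=
  Real.iSup_nonneg fun _ => Finset.sum_nonneg fun _ _ => abs_nonneg _

theorem abs_mulVec_le_rowSumNorm {κ μ : Type*} [Fintype κ] [Fintype μ] (B : Matrix κ μ ℝ)
    {w : μ → ℝ} {W : ℝ} (hW : 0 ≤ W) (hw : ∀ j, |w j| ≤ W) (i : κ) :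
    |(B *ᵥ w) i| ≤ rowSumNorm B * W := by
  calc |(B *ᵥ w) i| ≤ ∑ j, |B i j * w j| := Finset.abs_sum_le_sum_abs _ _
    _ ≤ ∑ j, |B i j| * W := by
      refine Finset.sum_le_sum fun j _ => ?_
      rw [abs_mul]
      gcongr
      exact hw j
    _ = (∑ j, |B i j|) * W := by rw [Finset.sum_mul]
    _ ≤ _ := by gcongr; exact rowSum_le_rowSumNorm B i

theorem mulVec_eq_sum_of_support {A : Matrix ι ι ℝ} {S : Finset ι} {u : ι → ℝ}
    (hu : ∀ p ∉ S, u p = 0) (p : ι) : (A *ᵥ u) p = ∑ q : S, A p q * u q := by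
  rw [Finset.sum_coe_sort S (fun q => A p q * u q), Matrix.mulVec, dotProduct]
  refine (Finset.sum_subset (Finset.subset_univ S) fun q _ hq => ?_).symm
  rw [hu q hq, mul_zero]

/-- The error Δ lives on S, where GΔ is at most W = λ + ρ + η‖Δ‖. Inverting the S block gives ‖Δ‖ ≤
c W, and c η ≤ α/8 absorbs the last term. Off S, irrepresentability turns W into (1 - α)W, leaving a
margin αλ for the perturbations. The weak bound |gradient| ≤ λ is enough, since uniqueness will come
from positive definiteness. -/
theorem primalDualWitness [DecidableEq ι] {A G : Matrix ι ι ℝ} {g v v₀ : ι → ℝ} {S : Finset ι}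
    {lam α ρ η : ℝ} (hlam : 0 ≤ lam) (hα : 0 < α) (hα1 : α ≤ 1) (hQ : IsUnit (block G S S))
    (hirr : Irrepresentable G S α) (hv₀ : ∀ p ∉ S, v₀ p = 0) (hv : ∀ p ∉ S, v p = 0)
    (hρ : ∀ p, |g p - (A *ᵥ v₀) p| ≤ ρ) (hη : ∀ p, ∑ q ∈ S, |A p q - G p q| ≤ η)
    (hη0 : 0 ≤ η) (hρ0 : 0 ≤ ρ)
    (hgrad : ∀ p ∈ S, |(A *ᵥ v) p - g p| ≤ lam) (hηα : cGamma G S * η ≤ α / 8)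
    (hρα : ρ ≤ lam * (α / 8)) :
    (∀ p, |v p - v₀ p| ≤ 2 * cGamma G S / (2 - α) * lam) ∧
      ∀ p ∉ S, |(A *ᵥ v) p - g p| ≤ lam := by
  set c := cGamma G S with hc
  have hc0 : 0 ≤ c := rowSumNorm_nonneg _
  set Δ := v - v₀ with hΔ
  have hΔS : ∀ p ∉ S, Δ p = 0 := fun p hp => by simp [hΔ, hv p hp, hv₀ p hp]
  set D := ‖Δ‖ with hD
  have hD0 : 0 ≤ D := norm_nonneg _
  have hΔD : ∀ p, |Δ p| ≤ D := fun p => norm_le_pi_norm Δ p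
  have hE : ∀ p, |(A *ᵥ Δ) p - (G *ᵥ Δ) p| ≤ η * D := by
    intro p
    rw [mulVec_eq_sum_of_support hΔS, mulVec_eq_sum_of_support hΔS, ← Finset.sum_sub_distrib]
    calc _ ≤ ∑ q : S, |A p q * Δ q - G p q * Δ q| := Finset.abs_sum_le_sum_abs _ _
      _ ≤ ∑ q : S, |A p q - G p q| * D := by
        refine Finset.sum_le_sum fun q _ => ?_
        rw [← sub_mul, abs_mul]
        gcongr
        exact hΔD q
      _ = (∑ q ∈ S, |A p q - G p q|) * D := by
        rw [← Finset.sum_mul, Finset.sum_coe_sort S (fun q => |A p q - G p q|)]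
      _ ≤ _ := by gcongr; exact hη p
  have hAΔ : ∀ p, (A *ᵥ Δ) p = ((A *ᵥ v) p - g p) + (g p - (A *ᵥ v₀) p) := by
    intro p
    rw [hΔ, Matrix.mulVec_sub, Pi.sub_apply]; ring
  set W := lam + ρ + η * D with hW
  have hW0 : 0 ≤ W := by positivity
  have hw : ∀ q : S, |(G *ᵥ Δ) q| ≤ W := by
    intro q
    have h1 := abs_le.1 (hE q)
    have h2 := abs_le.1 (hρ q)
    have h3 := abs_le.1 (hgrad q q.2)
    rw [hAΔ] at h1
    rw [_root_.abs_le]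
    constructor <;> linarith [h1.1, h1.2, h2.1, h2.2, h3.1, h3.2]
  set w : S → ℝ := fun q => (G *ᵥ Δ) q with hwdef
  have hQΔ : block G S S *ᵥ (fun q : S => Δ q) = w := by
    ext p
    rw [hwdef]
    simp only
    rw [mulVec_eq_sum_of_support hΔS]
    rfl
  have hdet : IsUnit (block G S S).det := (Matrix.isUnit_iff_isUnit_det _).1 hQ
  have hinv : (fun q : S => Δ q) = (block G S S)⁻¹ *ᵥ w := by
    rw [← hQΔ, Matrix.mulVec_mulVec, Matrix.nonsing_inv_mul _ hdet, Matrix.one_mulVec]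
  have hDle : D ≤ c * W := by
    refine (pi_norm_le_iff_of_nonneg (by positivity)).2 fun p => ?_
    by_cases hp : p ∈ S
    · have h1 := abs_mulVec_le_rowSumNorm (block G S S)⁻¹ hW0 hw ⟨p, hp⟩
      rw [← hinv] at h1
      exact h1
    · rw [hΔS p hp, norm_zero]; positivity
  have hDfin : D ≤ 2 * c / (2 - α) * lam := by
    have h2α : 0 < 2 - α := by linarith
    rw [div_mul_eq_mul_div, le_div_iff₀ h2α]
    have h1 : c * η * D ≤ α / 8 * D := by gcongr
    have h2 : c * ρ ≤ c * (lam * (α / 8)) := by gcongr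
    have h3 : D * (1 - α / 8) ≤ c * lam * (1 + α / 8) := by
      rw [hW] at hDle; linarith
    have h4 : 0 ≤ c * lam := by positivity
    have h5 : (1 + α / 8) * (2 - α) ≤ 2 * (1 - α / 8) := by nlinarith
    have h6 : D * (1 - α / 8) * (2 - α) ≤ c * lam * (1 + α / 8) * (2 - α) := by gcongr
    have h7 : c * lam * ((1 + α / 8) * (2 - α)) ≤ c * lam * (2 * (1 - α / 8)) := by gcongr
    have h8 : 0 < 1 - α / 8 := by linarith
    nlinarith
  refine ⟨fun p => (hΔD p).trans hDfin, fun p hp => ?_⟩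
  have hηD : η * D ≤ α / 4 * lam := by
    have h2α : 0 < 2 - α := by linarith
    have h1 : η * D ≤ η * (2 * c / (2 - α) * lam) := by gcongr
    have h2 : η * (2 * c / (2 - α) * lam) = (c * η) * (2 / (2 - α)) * lam := by ring
    have h3 : 2 / (2 - α) ≤ 2 := by
      rw [div_le_iff₀ h2α]; linarith
    have h4 : (c * η) * (2 / (2 - α)) * lam ≤ (α / 8) * 2 * lam := by gcongr
    linarith
  have hGp : |(G *ᵥ Δ) p| ≤ (1 - α) * W := by
    have hp' : p ∈ Sᶜ := Finset.mem_compl.2 hp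
    have h1 := abs_mulVec_le_rowSumNorm (block G Sᶜ S * (block G S S)⁻¹) hW0 hw ⟨p, hp'⟩
    have h2 : ((block G Sᶜ S * (block G S S)⁻¹) *ᵥ w) ⟨p, hp'⟩ = (G *ᵥ Δ) p := by
      rw [← Matrix.mulVec_mulVec, ← hinv, mulVec_eq_sum_of_support hΔS]
      rfl
    rw [h2] at h1
    refine h1.trans ?_
    gcongr
    exact hirr
  have h1 := abs_le.1 (hE p)
  have h2 := abs_le.1 (hρ p)
  have h3 := abs_le.1 hGp
  rw [hAΔ] at h1
  have hWle : (1 - α) * W ≤ (1 - α) * lam + ρ + α / 4 * lam := by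
    have h4 : (1 - α) * (ρ + η * D) ≤ 1 * (ρ + α / 4 * lam) := by
      gcongr
      linarith
    rw [hW]; linarith
  rw [_root_.abs_le]
  have h5 : 0 ≤ lam * α := by positivity
  constructor <;> linarith [h1.1, h1.2, h2.1, h2.2, h3.1, h3.2]

end PrimalDualWitness

/-! ### Matrix norms of entrywise bounded matrices with given support -/

section Norms

variable {m : ℕ} {B : Matrix (Fin m) (Fin m) ℝ} {S : Finset (Fin m × Fin m)} {b : ℝ}

theorem maxNorm_le (hb : 0 ≤ b) (hB : ∀ p : Fin m × Fin m, |B p.1 p.2| ≤ b) : maxNorm B ≤ b :=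
  Real.iSup_le hB hb

theorem frobNorm_le (hb : 0 ≤ b) (hB : ∀ p : Fin m × Fin m, |B p.1 p.2| ≤ b)
    (hS : ∀ p ∉ S, B p.1 p.2 = 0) : frobNorm B ≤ b * √(S.card) := by
  have h1 : ∑ i, ∑ j, B i j ^ 2 = ∑ p ∈ S, B p.1 p.2 ^ 2 := by
    rw [← Fintype.sum_prod_type (f := fun p : Fin m × Fin m => B p.1 p.2 ^ 2)]
    exact (Finset.sum_subset (Finset.subset_univ S) fun q _ hq => by simp [hS q hq]).symm
  have h2 : ∑ p ∈ S, B p.1 p.2 ^ 2 ≤ S.card * b ^ 2 := by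
    rw [← nsmul_eq_mul]
    refine Finset.sum_le_card_nsmul _ _ _ fun p _ => ?_
    exact sq_le_sq' (abs_le.1 (hB p)).1 (abs_le.1 (hB p)).2
  rw [frobNorm, h1]
  calc _ ≤ √(S.card * b ^ 2) := Real.sqrt_le_sqrt h2
    _ = _ := by rw [Real.sqrt_mul (by positivity), Real.sqrt_sq hb, mul_comm]

theorem specNorm_le_of_sq {c : ℝ} (hc : 0 ≤ c)
    (h : ∀ v : Fin m → ℝ, ∑ i, (B *ᵥ v) i ^ 2 ≤ c ^ 2 * ∑ i, v i ^ 2) : specNorm B ≤ c := by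
  refine ContinuousLinearMap.opNorm_le_bound _ hc fun v => ?_
  rw [EuclideanSpace.norm_eq, EuclideanSpace.norm_eq, ← Real.sqrt_sq hc, ← Real.sqrt_mul (sq_nonneg c)]
  refine Real.sqrt_le_sqrt ?_
  have := h v.ofLp
  simpa only [Real.norm_eq_abs, sq_abs, Matrix.ofLp_toEuclideanCLM] using this

theorem specNorm_le_frobNorm : specNorm B ≤ frobNorm B := by
  refine specNorm_le_of_sq (Real.sqrt_nonneg _) fun v => ?_
  have h : frobNorm B ^ 2 = ∑ i, ∑ j, B i j ^ 2 := Real.sq_sqrt (by positivity)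
  rw [h, Finset.sum_mul]
  exact Finset.sum_le_sum fun i _ => Finset.sum_mul_sq_le_sq_mul_sq Finset.univ (B i) v

/-- The Schur test: Cauchy–Schwarz with weights √|B_ij|. -/
theorem specNorm_le_of_row_col {c : ℝ} (hc : 0 ≤ c) (hrow : ∀ i, ∑ j, |B i j| ≤ c)
    (hcol : ∀ j, ∑ i, |B i j| ≤ c) : specNorm B ≤ c := by
  refine specNorm_le_of_sq hc fun v => ?_
  have h1 : ∀ i, (B *ᵥ v) i ^ 2 ≤ c * ∑ j, |B i j| * v j ^ 2 := by
    intro i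
    have h2 : |(B *ᵥ v) i| ≤ ∑ j, √|B i j| * (√|B i j| * |v j|) := by
      refine (Finset.abs_sum_le_sum_abs (fun j => B i j * v j) Finset.univ).trans
        (le_of_eq (Finset.sum_congr rfl fun j _ => ?_))
      rw [abs_mul, ← mul_assoc, Real.mul_self_sqrt (abs_nonneg _)]
    calc (B *ᵥ v) i ^ 2 = |(B *ᵥ v) i| ^ 2 := (sq_abs _).symm
      _ ≤ (∑ j, √|B i j| * (√|B i j| * |v j|)) ^ 2 := by gcongr
      _ ≤ (∑ j, √|B i j| ^ 2) * ∑ j, (√|B i j| * |v j|) ^ 2 := Finset.sum_mul_sq_le_sq_mul_sq _ _ _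
      _ = (∑ j, |B i j|) * ∑ j, |B i j| * v j ^ 2 := by
        simp only [mul_pow, Real.sq_sqrt (abs_nonneg _), sq_abs]
      _ ≤ _ := by
        gcongr
        exact hrow i
  calc ∑ i, (B *ᵥ v) i ^ 2 ≤ ∑ i, c * ∑ j, |B i j| * v j ^ 2 := Finset.sum_le_sum fun i _ => h1 i
    _ = c * ∑ j, (∑ i, |B i j|) * v j ^ 2 := by
      rw [← Finset.mul_sum, Finset.sum_comm]
      simp only [Finset.sum_mul]
    _ ≤ c * ∑ j, c * v j ^ 2 := by
      gcongr with j _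
      exact hcol j
    _ = _ := by rw [← Finset.mul_sum]; ring

theorem card_col_le_colDegree (K : Matrix (Fin m) (Fin m) ℝ) (j : Fin m) :
    (Finset.univ.filter fun i => K i j ≠ 0).card ≤ colDegree K :=
  Finset.le_sup (f := fun j => (Finset.univ.filter fun i => K i j ≠ 0).card) (Finset.mem_univ j)

theorem col_sum_le {K : Matrix (Fin m) (Fin m) ℝ} {f : Fin m → ℝ} (j : Fin m) (hb : 0 ≤ b)
    (hf : ∀ i, |f i| ≤ b) (hf0 : ∀ i, K i j = 0 → f i = 0) : ∑ i, |f i| ≤ b * colDegree K := by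
  have h1 : ∑ i, |f i| = ∑ i ∈ Finset.univ.filter fun i => K i j ≠ 0, |f i| := by
    refine (Finset.sum_subset (Finset.subset_univ _) fun i _ hi => ?_).symm
    rw [hf0 i (by simpa using hi), abs_zero]
  rw [h1]
  calc _ ≤ ((Finset.univ.filter fun i => K i j ≠ 0).card : ℝ) * b := by
        rw [← nsmul_eq_mul]
        exact Finset.sum_le_card_nsmul _ _ _ fun i _ => hf i
    _ ≤ colDegree K * b := by
        gcongr
        exact card_col_le_colDegree K j
    _ = _ := mul_comm _ _

/-- Symmetry of K makes its column degree bound the rows as well, so both sums in the Schur test are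
at most b d. -/
theorem specNorm_le {K : Matrix (Fin m) (Fin m) ℝ} (hK : K.IsHermitian) (hb : 0 ≤ b)
    (hB : ∀ p : Fin m × Fin m, |B p.1 p.2| ≤ b) (hS : ∀ p ∉ supp K, B p.1 p.2 = 0) :
    specNorm B ≤ b * min (√((supp K).card)) (colDegree K) := by
  rw [mul_min_of_nonneg _ _ hb]
  refine le_min (specNorm_le_frobNorm.trans (frobNorm_le hb hB hS)) ?_
  have hz : ∀ i j, K i j = 0 → B i j = 0 := fun i j h => hS (i, j) (by simp [supp, h])
  refine specNorm_le_of_row_col (by positivity) (fun i => ?_) fun j => ?_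
  · refine col_sum_le i hb (fun j => hB (i, j)) fun j h => hz i j ?_
    have := hK.apply i j
    simp only [star_trivial] at this
    rw [← this, h]
  · exact col_sum_le j hb (fun i => hB (i, j)) fun i h => hz i j h

end Norms

/-! ### The sample score matching loss -/

section Sample

variable {n m : ℕ} {h : Fin m → ℝ → ℝ} {δ lam : ℝ} {x : Fin n → Fin m → ℝ}

theorem regLoss_eq_lassoLoss (B : Matrix (Fin m) (Fin m) ℝ) :
    regLoss h δ lam x B = lassoLoss (amplifiedGamma h δ x) (sampleG h x) lam (vec B) := rfl

theorem gammaTerm_comm (y : Fin m → ℝ) (p q : Fin m × Fin m) :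
    gammaTerm h y p q = gammaTerm h y q p := by
  unfold gammaTerm
  by_cases hpq : p.2 = q.2
  · rw [if_pos hpq, if_pos hpq.symm, hpq]; ring
  · rw [if_neg hpq, if_neg (Ne.symm hpq)]

theorem transpose_amplifiedGamma : (amplifiedGamma h δ x)ᵀ = amplifiedGamma h δ x := by
  rw [amplifiedGamma, Matrix.transpose_add, Matrix.diagonal_transpose]
  congr 1
  ext p q
  simp only [Matrix.transpose_apply, sampleGamma, gammaTerm_comm]

theorem dotProduct_gammaTerm (y : Fin m → ℝ) (u : Fin m × Fin m → ℝ) :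
    u ⬝ᵥ (gammaTerm h y *ᵥ u) = ∑ j, h j (y j) * (∑ k, u (k, j) * y k) ^ 2 := by
  simp only [dotProduct, Matrix.mulVec, Fintype.sum_prod_type, gammaTerm, ite_mul, zero_mul,
    Finset.sum_ite_eq, Finset.mem_univ, if_true]
  rw [Finset.sum_comm]
  refine Finset.sum_congr rfl fun j _ => ?_
  rw [sq, Finset.sum_mul_sum, Finset.mul_sum]
  refine Finset.sum_congr rfl fun k _ => ?_
  rw [Finset.mul_sum, Finset.mul_sum]
  refine Finset.sum_congr rfl fun l _ => ?_
  ring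

/-- The sample Γ is an average of sums of squares, hence only semidefinite in general; positivity
comes from (δ - 1) times its strictly positive diagonal. -/
theorem amplifiedGamma_pos (hn : 0 < n) (hδ : 1 < δ)
    (hx : ∀ i j, 0 < x i j ∧ 0 < h j (x i j)) (u : Fin m × Fin m → ℝ) (hu : u ≠ 0) :
    0 < u ⬝ᵥ (amplifiedGamma h δ x *ᵥ u) := by
  have hn' : (0 : ℝ) < n := by exact_mod_cast hn
  have : Nonempty (Fin n) := ⟨⟨0, hn⟩⟩
  have h1 : u ⬝ᵥ (sampleGamma h x *ᵥ u) = 1 / (n : ℝ) * ∑ i, u ⬝ᵥ (gammaTerm h (x i) *ᵥ u) := by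
    have : sampleGamma h x = (1 / (n : ℝ)) • ∑ i, gammaTerm h (x i) := by
      ext p q
      simp [sampleGamma, Matrix.sum_apply]
    rw [this, Matrix.smul_mulVec, dotProduct_smul, Matrix.sum_mulVec, dotProduct_sum, smul_eq_mul]
  have h2 : 0 ≤ u ⬝ᵥ (sampleGamma h x *ᵥ u) := by
    rw [h1]
    refine mul_nonneg (by positivity) (Finset.sum_nonneg fun i _ => ?_)
    rw [dotProduct_gammaTerm]
    exact Finset.sum_nonneg fun j _ => mul_nonneg (hx i j).2.le (sq_nonneg _)
  have h3 : ∀ p, 0 < sampleGamma h x p p := by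
    intro p
    refine mul_pos (by positivity) (Finset.sum_pos (fun i _ => ?_) Finset.univ_nonempty)
    have := (hx i p.1).1
    have := (hx i p.2).2
    simp only [gammaTerm, if_true]
    positivity
  rw [amplifiedGamma, Matrix.add_mulVec, dotProduct_add]
  refine add_pos_of_nonneg_of_pos h2 ?_
  obtain ⟨p, hp⟩ := Function.ne_iff.1 hu
  have h4 : ∀ q, u q * ((Matrix.diagonal fun p => (δ - 1) * sampleGamma h x p p) *ᵥ u) q =
      (δ - 1) * sampleGamma h x q q * u q ^ 2 := by
    intro q
    rw [Matrix.mulVec_diagonal]; ring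
  have h5 : 0 < δ - 1 := by linarith
  rw [dotProduct]
  simp only [h4]
  refine Finset.sum_pos' (fun q _ => ?_) ⟨p, Finset.mem_univ p, ?_⟩
  · have := h3 q
    positivity
  · have := h3 p
    have : u p ≠ 0 := hp
    positivity

theorem sampleGamma_eq_zero {p q : Fin m × Fin m} (hpq : p.2 ≠ q.2) : sampleGamma h x p q = 0 := by
  simp [sampleGamma, gammaTerm, hpq]

theorem popGamma_eq_zero {P₀ : Measure (Fin m → ℝ)} {p q : Fin m × Fin m} (hpq : p.2 ≠ q.2) :
    popGamma h P₀ p q = 0 := by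
  simp [popGamma, gammaTerm, hpq]

theorem amplifiedGamma_eq_zero {p q : Fin m × Fin m} (hpq : p.2 ≠ q.2) :
    amplifiedGamma h δ x p q = 0 := by
  have : p ≠ q := fun h => hpq (h ▸ rfl)
  simp [amplifiedGamma, sampleGamma_eq_zero hpq, this]

/-- Entrywise bounds on the sample quantities give the oracle properties of the estimator. -/
theorem estimator_of_bounds {K₀ : Matrix (Fin m) (Fin m) ℝ} (hK : K₀.PosDef) (hn : 0 < n)
    (hδ : 1 < δ) (hx : ∀ i j, 0 < x i j ∧ 0 < h j (x i j))
    {Γ₀ : Matrix (Fin m × Fin m) (Fin m × Fin m) ℝ} {g₀ : Fin m × Fin m → ℝ} {α ε ε' : ℝ}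
    (hα : 0 < α) (hα1 : α ≤ 1) (hQ : IsUnit (block Γ₀ (supp K₀) (supp K₀)))
    (hirr : Irrepresentable Γ₀ (supp K₀) α) (hΓg : Γ₀ *ᵥ vec K₀ = g₀)
    (hΓ₀ : ∀ p q : Fin m × Fin m, p.2 ≠ q.2 → Γ₀ p q = 0) (hlam : 0 ≤ lam)
    (hε : ∀ p q, |amplifiedGamma h δ x p q - Γ₀ p q| ≤ ε) (hε0 : 0 ≤ ε)
    (hε' : ∀ p, |sampleG h x p - g₀ p| ≤ ε') (hε'0 : 0 ≤ ε')
    (hηα : cGamma Γ₀ (supp K₀) * (ε * colDegree K₀) ≤ α / 8)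
    (hρα : ε' + ε * rowSumNorm K₀ ≤ lam * (α / 8)) :
    ∃ Khat : Matrix (Fin m) (Fin m) ℝ, IsEstimator h δ lam x Khat ∧
      (∀ K, IsEstimator h δ lam x K → K = Khat) ∧ supp Khat ⊆ supp K₀ ∧
      ∀ p : Fin m × Fin m, |(Khat - K₀) p.1 p.2| ≤ 2 * cGamma Γ₀ (supp K₀) / (2 - α) * lam := by
  set A := amplifiedGamma h δ x with hAdef
  set g := sampleG h x with hg
  set S := supp K₀ with hS
  have hA : Aᵀ = A := transpose_amplifiedGamma
  have hApos := amplifiedGamma_pos (h := h) (x := x) hn hδ hx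
  have hvK : ∀ p ∉ S, vec K₀ p = 0 := fun p hp => by
    simpa [hS, supp, vec] using hp
  obtain ⟨v, hv, hmin⟩ := exists_isMinOn_lassoLoss (g := g) hApos hlam S
  have hfo := fun p (hp : p ∈ S) => first_order_of_isMinOn hA hlam hv hmin hp
  -- The blocks act on columns of K₀, whereas c_K is a row sum; symmetry identifies the two.
  have hcol : ∀ j, ∑ l, |K₀ l j| ≤ rowSumNorm K₀ := by
    intro j
    have : ∀ l, K₀ l j = K₀ j l := fun l => by simpa using hK.isHermitian.apply j l
    simp only [this]
    exact rowSum_le_rowSumNorm K₀ j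
  have hρ : ∀ p, |g p - (A *ᵥ vec K₀) p| ≤ ε' + ε * rowSumNorm K₀ := by
    intro p
    have e1 : g p - (A *ᵥ vec K₀) p = (g p - g₀ p) - ((A - Γ₀) *ᵥ vec K₀) p := by
      rw [Matrix.sub_mulVec, Pi.sub_apply, hΓg]; ring
    have e2 : |((A - Γ₀) *ᵥ vec K₀) p| ≤ ε * rowSumNorm K₀ := by
      calc |((A - Γ₀) *ᵥ vec K₀) p| ≤ ∑ q, |(A - Γ₀) p q * vec K₀ q| :=
            Finset.abs_sum_le_sum_abs (fun q => (A - Γ₀) p q * vec K₀ q) Finset.univ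
        _ ≤ ∑ q : Fin m × Fin m, if p.2 = q.2 then ε * |K₀ q.1 q.2| else 0 := by
          refine Finset.sum_le_sum fun q _ => ?_
          split_ifs with hpq
          · rw [abs_mul]
            exact mul_le_mul_of_nonneg_right (hε p q) (abs_nonneg _)
          · rw [Matrix.sub_apply, hAdef, amplifiedGamma_eq_zero hpq, hΓ₀ p q hpq]
            simp
        _ = ε * ∑ l, |K₀ l p.2| := by
          rw [Fintype.sum_prod_type]
          simp [Finset.mul_sum]
        _ ≤ _ := by gcongr; exact hcol _
    rw [e1]
    exact (abs_sub _ _).trans (add_le_add (hε' p) e2)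
  have hη : ∀ p, ∑ q ∈ S, |A p q - Γ₀ p q| ≤ ε * colDegree K₀ := by
    intro p
    have e1 : ∑ q ∈ S, |A p q - Γ₀ p q| =
        ∑ l, |if K₀ l p.2 ≠ 0 then A p (l, p.2) - Γ₀ p (l, p.2) else 0| := by
      calc ∑ q ∈ S, |A p q - Γ₀ p q| = ∑ q : Fin m × Fin m, if p.2 = q.2 then
            |if K₀ q.1 p.2 ≠ 0 then A p (q.1, p.2) - Γ₀ p (q.1, p.2) else 0| else 0 := by
            rw [← Finset.sum_subset (Finset.subset_univ S)]
            · refine Finset.sum_congr rfl fun q hq => ?_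
              split_ifs with h1 h2
              · rw [h1]
              · exact absurd (by rw [h1]; simpa [hS, supp] using hq) h2
              · rw [hAdef, amplifiedGamma_eq_zero h1, hΓ₀ p q h1, sub_zero, abs_zero]
            · intro q _ hq
              have hq0 : K₀ q.1 q.2 = 0 := hvK q hq
              split_ifs with h1 h2
              · exact absurd (by rw [h1]; exact hq0) h2
              · exact abs_zero
              · rfl
        _ = _ := by
            rw [Fintype.sum_prod_type]
            simp
    rw [e1]
    refine col_sum_le p.2 hε0 (fun l => ?_) fun l hl => by simp [hl]
    split_ifs
    · exact hε _ _
    · simpa using hε0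
  have hrow0 : 0 ≤ rowSumNorm K₀ := rowSumNorm_nonneg _
  obtain ⟨hb, hdual⟩ := primalDualWitness (A := A) (g := g) hlam hα hα1 hQ hirr hvK hv hρ hη
    (by positivity) (by positivity)
    (fun p hp => abs_gradient_le_of_first_order hlam (hfo p hp)) hηα hρα
  -- Off S₀ the witness vanishes, so the first-order condition there is just |gradient| ≤ λ.
  have hglob : ∀ p (t : ℝ), 0 ≤ t * ((A *ᵥ v) p - g p) + lam * (|v p + t| - |v p|) := by
    intro p t
    by_cases hp : p ∈ S
    · exact hfo p hp t
    · rw [hv p hp, zero_add, abs_zero, sub_zero]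
      have h1 : |t * ((A *ᵥ v) p - g p)| ≤ |t| * lam := by
        rw [abs_mul]
        exact mul_le_mul_of_nonneg_left (hdual p hp) (abs_nonneg _)
      linarith [neg_abs_le (t * ((A *ᵥ v) p - g p))]
  have hopt := lassoLoss_add_le_of_first_order hA hglob
  set Khat : Matrix (Fin m) (Fin m) ℝ := fun i j => v (i, j) with hKhat
  have hvec : vec Khat = v := rfl
  refine ⟨Khat, fun K => ?_, fun K hKe => ?_, fun p hp => ?_, hb⟩
  · rw [regLoss_eq_lassoLoss, regLoss_eq_lassoLoss, hvec]
    have h1 := hopt (vec K)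
    by_cases h0 : vec K - v = 0
    · rw [h0] at h1; simpa using h1
    · have := hApos _ h0
      linarith
  · have h1 := hKe Khat
    rw [regLoss_eq_lassoLoss, regLoss_eq_lassoLoss, hvec] at h1
    have h2 := hopt (vec K)
    by_contra hne
    have h0 : vec K - v ≠ 0 := by
      intro h0
      apply hne
      ext i j
      exact congrFun (sub_eq_zero.1 h0) (i, j)
    have := hApos _ h0
    linarith
  · by_contra hpS
    have := hv p hpS
    simp only [supp, Finset.mem_filter, Finset.mem_univ, true_and] at hp
    exact hp this

end Sample

/-! ### Scalar estimates -/

theorem sqrt_add_two_mul_le {y : ℝ} (hy : 0 ≤ y) : √(2 * y) + 2 * y ≤ 2 * (√y + y) := by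
  have : √(2 * y) ≤ 2 * √y := by
    rw [Real.sqrt_le_left (by positivity), mul_pow, Real.sq_sqrt hy]
    linarith
  linarith

/-- For n = 0 the quotient is 0 by convention, and for m ≤ 1 the logarithm is 0; either way the
bound equals 1, leaving no room for δ. -/
theorem pos_of_one_lt_multiplierBound {n m : ℕ} (h : 1 < multiplierBound n m) :
    0 < n ∧ 2 ≤ m := by
  constructor
  · by_contra h0
    obtain rfl : n = 0 := by omega
    norm_num [multiplierBound] at h
  · by_contra h0
    have : Real.log m = 0 := by
      have : m = 0 ∨ m = 1 := by omega
      rcases this with rfl | rfl <;> simp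
    rw [multiplierBound, this] at h
    norm_num at h

/-- From 1 - 1/(1 + t) ≤ t with t = 4e·max{z, √z}. Here 4e ≤ 12, and τ > 3 gives z ≤ 2y, whence 24 =
12 · 2. -/
theorem sub_one_le_of_lt_multiplierBound {n m : ℕ} {δ τ : ℝ} (h : δ < multiplierBound n m)
    (hτ : 3 < τ) : δ - 1 ≤ 1 ∧
      δ - 1 ≤ 24 * (√(τ * Real.log m / n) + τ * Real.log m / n) := by
  set y := τ * Real.log m / n with hy
  set z := 6 * Real.log m / n with hz
  have hlog : 0 ≤ Real.log m := Real.log_natCast_nonneg m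
  have hz0 : 0 ≤ z := by positivity
  have hy0 : 0 ≤ y := by positivity
  have hzy : z ≤ 2 * y := by
    rw [hz, hy, ← mul_div_assoc]
    exact div_le_div_of_nonneg_right (by nlinarith) (Nat.cast_nonneg n)
  set w := max z (√z) with hw
  have hw0 : 0 ≤ w := le_max_of_le_left hz0
  have hwy : w ≤ 2 * (√y + y) := by
    refine le_trans (max_le ?_ ?_) (sqrt_add_two_mul_le hy0)
    · have := Real.sqrt_nonneg (2 * y); linarith
    · have := Real.sqrt_le_sqrt hzy; linarith
  set t := 4 * Real.exp 1 * w with ht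
  have ht0 : 0 ≤ t := by positivity
  have hmb : multiplierBound n m = 2 - (1 + t)⁻¹ := rfl
  rw [hmb] at h
  have h1 : 0 ≤ (1 + t)⁻¹ := by positivity
  have h2 : 1 - t ≤ (1 + t)⁻¹ := by
    rw [← one_div, le_div_iff₀ (by positivity)]
    nlinarith
  refine ⟨by linarith, ?_⟩
  have h3 : t ≤ 12 * w := by
    have := Real.exp_one_lt_d9
    rw [ht]
    gcongr
    linarith
  linarith

theorem sample_size_bound {B α y : ℝ} (hB : 0 ≤ B) (hα : 0 < α) (hy : 0 ≤ y)
    (h : 48000 ^ 2 * (y * max ((B / α) ^ 2) (B / α)) ≤ 1) :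
    3000 * (B * (√y + y)) ≤ α / 8 := by
  set x := B / α with hx
  have hx0 : 0 ≤ x := by positivity
  have hBx : B = x * α := by rw [hx]; field_simp
  have h1 : y * x ^ 2 ≤ (1 / 48000) ^ 2 := by
    have := mul_le_mul_of_nonneg_left (le_max_left (x ^ 2) x) hy
    linarith
  have h2 : y * x ≤ 1 / 48000 ^ 2 := by
    have := mul_le_mul_of_nonneg_left (le_max_right (x ^ 2) x) hy
    linarith
  have h3 : x * √y ≤ 1 / 48000 := by
    refine le_of_sq_le_sq ?_ (by norm_num)
    rw [mul_pow, Real.sq_sqrt hy]; linarith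
  have h4 : x * (√y + y) ≤ 1 / 24000 := by
    have : (1 : ℝ) / 48000 ^ 2 ≤ 1 / 48000 := by norm_num
    linarith
  calc 3000 * (B * (√y + y)) = 3000 * α * (x * (√y + y)) := by rw [hBx]; ring
    _ ≤ 3000 * α * (1 / 24000) := by gcongr
    _ = α / 8 := by ring

/-- The deviation level 2τ log m leaves m^(6 - 2τ), the square of m^(3 - τ) < 1. -/
theorem union_bound_le {m : ℕ} (hm : 2 ≤ m) {τ : ℝ} (hτ : 3 < τ) :
    ((m : ℝ) ^ 4 + (m : ℝ) ^ 2) * (2 * Real.exp (-(2 * (τ * Real.log m)))) ≤ (m : ℝ) ^ (3 - τ) := by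
  have hm' : (2 : ℝ) ≤ m := by exact_mod_cast hm
  have hm0 : (0 : ℝ) < m := by linarith
  have h1 : Real.exp (-(2 * (τ * Real.log m))) = (m : ℝ) ^ (-(2 * τ)) := by
    rw [Real.rpow_def_of_pos hm0]; congr 1; ring
  have h2 : ((m : ℝ) ^ 4 + (m : ℝ) ^ 2) * 2 ≤ (m : ℝ) ^ 6 := by
    have e1 : (4 : ℝ) ≤ (m : ℝ) ^ 2 := by nlinarith
    have e2 : (m : ℝ) ^ 2 ≤ (m : ℝ) ^ 4 := pow_le_pow_right₀ (by linarith) (by norm_num)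
    have e3 : (m : ℝ) ^ 4 * 4 ≤ (m : ℝ) ^ 4 * (m : ℝ) ^ 2 := by gcongr
    have e4 : (m : ℝ) ^ 4 * (m : ℝ) ^ 2 = (m : ℝ) ^ 6 := by ring
    linarith
  calc _ = ((m : ℝ) ^ 4 + (m : ℝ) ^ 2) * 2 * (m : ℝ) ^ (-(2 * τ)) := by rw [h1]; ring
    _ ≤ (m : ℝ) ^ 6 * (m : ℝ) ^ (-(2 * τ)) := by gcongr
    _ = (m : ℝ) ^ (6 + -(2 * τ)) := by
      rw [Real.rpow_add hm0]; norm_cast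
    _ ≤ _ := Real.rpow_le_rpow_of_exponent_le (by linarith) (by linarith)

/-! ### The high-probability event -/

section Event

variable {n m : ℕ} {K₀ : Matrix (Fin m) (Fin m) ℝ} {Ω : Type*} [MeasurableSpace Ω]
  {P : Measure Ω} [IsProbabilityMeasure P] {X : Fin n → Ω → Fin m → ℝ}
  {h : Fin m → ℝ → ℝ} {M M' : ℝ}

theorem exists_event (H : BoundedWeights h M M') (hK : K₀.PosDef) (hn : 0 < n) (hm : 2 ≤ m)
    (hX : ∀ i, HasLaw (X i) (truncNormal 0 K₀) P) (hind : iIndepFun X P) {τ : ℝ} (hτ : 3 < τ) :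
    ∃ E : Set Ω, MeasurableSet E ∧ ENNReal.ofReal (1 - (m : ℝ) ^ (3 - τ)) ≤ P E ∧
      ∀ ω ∈ E, (∀ i j, 0 < X i ω j ∧ 0 < h j (X i ω j)) ∧
        (∀ p q, |sampleGamma h (fun i => X i ω) p q - popGamma h (truncNormal 0 K₀) p q| ≤
          640 * (M * cX K₀ ^ 2) * (√(τ * Real.log m / n) + τ * Real.log m / n)) ∧
        ∀ p, |sampleG h (fun i => X i ω) p - ∫ x, gTerm h x p ∂(truncNormal 0 K₀)| ≤
          80 * (M' * cX K₀ + M) * (√(τ * Real.log m / n) + τ * Real.log m / n) := by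
  have := isProbabilityMeasure_truncNormal hK
  set y := τ * Real.log m / n with hy
  have hlog : 0 ≤ Real.log m := Real.log_natCast_nonneg m
  have hy0 : 0 ≤ y := by positivity
  set u := 2 * (τ * Real.log m) with hu
  have hu0 : 0 ≤ u := by positivity
  have huy : u / n = 2 * y := by rw [hu, hy]; ring
  set j₀ : Fin m := ⟨0, by omega⟩
  have hM := H.M_pos j₀
  have hM' := H.M'_nonneg j₀
  have hc := cX_pos hK j₀
  have hsq := sqrt_add_two_mul_le hy0
  set D₁ : (Fin m × Fin m) × (Fin m × Fin m) → Set Ω := fun pq =>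
    {ω | 10 * (32 * M * cX K₀ ^ 2) * (√(u / n) + u / n) ≤
      |1 / (n : ℝ) * ∑ i, gammaTerm h (X i ω) pq.1 pq.2 -
        ∫ x, gammaTerm h x pq.1 pq.2 ∂(truncNormal 0 K₀)|} with hD₁
  set D₂ : Fin m × Fin m → Set Ω := fun p =>
    {ω | 10 * (4 * (M' * cX K₀ + M)) * (√(u / n) + u / n) ≤
      |1 / (n : ℝ) * ∑ i, gTerm h (X i ω) p - ∫ x, gTerm h x p ∂(truncNormal 0 K₀)|} with hD₂
  set N : Set Ω := {ω | ¬ ∀ i j, 0 < X i ω j ∧ 0 < h j (X i ω j)} with hN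
  have hN0 : P N = 0 := by
    rw [← ae_iff, ae_all_iff]
    intro i
    have h1 : ∀ᵐ x ∂(P.map (X i)), ∀ j, 0 < x j ∧ 0 < h j (x j) := by
      rw [(hX i).map_eq]
      filter_upwards [H.ae (K := K₀)] with x hx j
      exact ⟨(hx j).1, (hx j).2.1⟩
    exact ae_of_ae_map (hX i).aemeasurable h1
  set B : Set Ω := ((⋃ pq, D₁ pq) ∪ ⋃ p, D₂ p) ∪ N with hB
  have hPB : P B ≤ ENNReal.ofReal ((m : ℝ) ^ (3 - τ)) := by
    calc P B ≤ (∑ pq, P (D₁ pq) + ∑ p, P (D₂ p)) + 0 := by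
          refine (measure_union_le _ _).trans (add_le_add ((measure_union_le _ _).trans
            (add_le_add ?_ ?_)) hN0.le)
          · exact measure_iUnion_fintype_le _ _
          · exact measure_iUnion_fintype_le _ _
      _ ≤ (∑ _pq : (Fin m × Fin m) × (Fin m × Fin m), ENNReal.ofReal (2 * Real.exp (-u)) +
          ∑ _p : Fin m × Fin m, ENNReal.ofReal (2 * Real.exp (-u))) + 0 := by
          gcongr with pq _ p _
          · exact (H.subExp_gammaTerm hK pq.1 pq.2).measure_deviation_le hn hX hind hu0
          · exact (H.subExp_gTerm hK p).measure_deviation_le hn hX hind hu0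
      _ = ENNReal.ofReal (((m : ℝ) ^ 4 + (m : ℝ) ^ 2) * (2 * Real.exp (-u))) := by
          rw [add_zero, Finset.sum_const, Finset.sum_const, nsmul_eq_mul, nsmul_eq_mul, ← add_mul,
            ENNReal.ofReal_mul (p := (m : ℝ) ^ 4 + (m : ℝ) ^ 2) (by positivity)]
          congr 1
          rw [ENNReal.ofReal_add (by positivity) (by positivity),
            ENNReal.ofReal_pow (by positivity), ENNReal.ofReal_pow (by positivity)]
          simp only [Finset.card_univ, Fintype.card_prod, Fintype.card_fin, ENNReal.ofReal_natCast]
          push_cast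
          ring
      _ ≤ _ := ENNReal.ofReal_le_ofReal (union_bound_le hm hτ)
  -- The observations are only a.e. measurable, so the bad set is replaced by a measurable hull of
  -- equal measure.
  refine ⟨(toMeasurable P B)ᶜ, (measurableSet_toMeasurable P B).compl, ?_, fun ω hω => ?_⟩
  · rw [prob_compl_eq_one_sub (measurableSet_toMeasurable P B), measure_toMeasurable,
      ENNReal.ofReal_sub _ (by positivity), ENNReal.ofReal_one]
    gcongr
  · have hωB : ω ∉ B := fun h => hω (subset_toMeasurable P B h)
    simp only [hB, Set.mem_union, Set.mem_iUnion, not_or, not_exists] at hωB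
    obtain ⟨⟨h1, h2⟩, h3⟩ := hωB
    refine ⟨not_not.1 h3, fun p q => ?_, fun p => ?_⟩
    · have h4 := h1 (p, q)
      simp only [hD₁, Set.mem_ofPred_eq, not_le] at h4
      refine h4.le.trans ?_
      rw [huy]
      calc _ ≤ 10 * (32 * M * cX K₀ ^ 2) * (2 * (√y + y)) := by gcongr
        _ = _ := by ring
    · have h4 := h2 p
      simp only [hD₂, Set.mem_ofPred_eq, not_le] at h4
      refine h4.le.trans ?_
      rw [huy]
      calc _ ≤ 10 * (4 * (M' * cX K₀ + M)) * (2 * (√y + y)) := by gcongr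
        _ = _ := by ring

/-- On the diagonal the amplifier multiplies the mean, where δ - 1 ≤ 24s is used, and the
fluctuation, where δ - 1 ≤ 1 suffices: 640 + 24·64 + 640 ≤ 3000. -/
theorem abs_amplifiedGamma_sub_le {x : Fin n → Fin m → ℝ} {δ s L : ℝ}
    {G : Matrix (Fin m × Fin m) (Fin m × Fin m) ℝ} (hδ : 1 < δ) (hδ1 : δ - 1 ≤ 1)
    (hδs : δ - 1 ≤ 24 * s) (hs : 0 ≤ s) (hL : 0 ≤ L) (hG : ∀ p q, |G p q| ≤ 64 * L)
    (hdev : ∀ p q, |sampleGamma h x p q - G p q| ≤ 640 * L * s) (p q : Fin m × Fin m) :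
    |amplifiedGamma h δ x p q - G p q| ≤ 3000 * L * s := by
  have hLs : 0 ≤ L * s := by positivity
  rw [amplifiedGamma, Matrix.add_apply, Matrix.diagonal_apply]
  split_ifs with hpq
  · have h1 : |sampleGamma h x p p| ≤ 64 * L + 640 * L * s := by
      have := abs_sub_abs_le_abs_sub (sampleGamma h x p p) (G p p)
      linarith [hG p p, hdev p p]
    have h2 : |(δ - 1) * sampleGamma h x p p| ≤ 24 * s * (64 * L) + 1 * (640 * L * s) := by
      rw [abs_mul, abs_of_pos (by linarith)]
      calc (δ - 1) * |sampleGamma h x p p| ≤ (δ - 1) * (64 * L + 640 * L * s) := by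
            gcongr
        _ = (δ - 1) * (64 * L) + (δ - 1) * (640 * L * s) := by ring
        _ ≤ _ := by gcongr
    have h3 := abs_add_le (sampleGamma h x p q - G p q) ((δ - 1) * sampleGamma h x p p)
    rw [show sampleGamma h x p q + (δ - 1) * sampleGamma h x p p - G p q =
      sampleGamma h x p q - G p q + (δ - 1) * sampleGamma h x p p by ring]
    linarith [hdev p q]
  · rw [add_zero]
    linarith [hdev p q]

end Event

end GSM

/-! ### Choice of constants and conclusion -/

theorem mainTheorem11 :
    ∃ C₁ C₂ : ℝ, 0 < C₁ ∧ 0 < C₂ ∧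
    ∀ (n m : ℕ) (K₀ : Matrix (Fin m) (Fin m) ℝ), K₀.PosDef →
    ∀ (Ω : Type*) [MeasurableSpace Ω] (P : Measure Ω) [IsProbabilityMeasure P]
      (X : Fin n → Ω → Fin m → ℝ),
      (∀ i, HasLaw (X i) (GSM.truncNormal 0 K₀) P) → iIndepFun X P →
    ∀ (h : Fin m → ℝ → ℝ) (M M' : ℝ), GSM.MemH 1 1 h →
      (∀ j, ∀ᵐ x ∂(volume.restrict (Set.Ioi (0 : ℝ))), 0 ≤ h j x ∧ h j x ≤ M) →
      (∀ j, ∀ᵐ x ∂(volume.restrict (Set.Ioi (0 : ℝ))), 0 ≤ deriv (h j) x ∧ deriv (h j) x ≤ M') →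
    ∀ δ : ℝ, 1 < δ → δ < GSM.multiplierBound n m →
    ∀ (S₀ : Finset (Fin m × Fin m)) (Γ₀ : Matrix (Fin m × Fin m) (Fin m × Fin m) ℝ),
      S₀ = GSM.supp K₀ → Γ₀ = GSM.popGamma h (GSM.truncNormal 0 K₀) →
    ∀ α : ℝ, 0 < α → α ≤ 1 → IsUnit (GSM.block Γ₀ S₀ S₀) → GSM.Irrepresentable Γ₀ S₀ α →
    ∀ cΓ cX cK d : ℝ, cΓ = GSM.cGamma Γ₀ S₀ → cX = GSM.cX K₀ → cK = GSM.rowSumNorm K₀ →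
      d = GSM.colDegree K₀ →
    ∀ τ lam : ℝ, 3 < τ →
      C₁ * (τ * Real.log m *
        max (M ^ 2 * cΓ ^ 2 * cX ^ 4 * d ^ 2 / α ^ 2) (M * cΓ * cX ^ 2 * d / α)) < n →
      C₂ * ((2 - α) / α * (M * cK * cX ^ 2 + M' * cX + M) *
        (√(τ * Real.log m / n) + τ * Real.log m / n)) < lam →
    ∃ E : Set Ω, MeasurableSet E ∧ ENNReal.ofReal (1 - (m : ℝ) ^ (3 - τ)) ≤ P E ∧
    ∀ ω ∈ E, ∃ Khat : Matrix (Fin m) (Fin m) ℝ,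
      GSM.IsEstimator h δ lam (fun i => X i ω) Khat ∧
      (∀ K, GSM.IsEstimator h δ lam (fun i => X i ω) K → K = Khat) ∧
      GSM.supp Khat ⊆ S₀ ∧
      GSM.maxNorm (Khat - K₀) ≤ 2 * cΓ / (2 - α) * lam ∧
      GSM.frobNorm (Khat - K₀) ≤ 2 * cΓ / (2 - α) * lam * √(S₀.card) ∧
      GSM.specNorm (Khat - K₀) ≤ 2 * cΓ / (2 - α) * lam * min (√(S₀.card)) d ∧
      ((∀ p ∈ S₀, 2 * cΓ / (2 - α) * lam < |K₀ p.1 p.2|) →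
        GSM.supp Khat = S₀ ∧
        ∀ p ∈ S₀, SignType.sign (Khat p.1 p.2) = SignType.sign (K₀ p.1 p.2)) := by
  -- The second constant is 8 · 3000, from requiring the total error 3000·R·s to be at most λα/8.
  -- The first makes both √y and y, scaled by B/α, at most 1/48000, so that 3000·B(√y + y) ≤ α/8.
  refine ⟨48000 ^ 2, 24000, by norm_num, by norm_num, ?_⟩
  intro n m K₀ hK Ω _ P _ X hX hind h M M' hmem hM hM' δ hδ hδC S₀ Γ₀ hS hΓ α hα hα1 hQ hirr
    cΓ cX cK d hcΓ hcX hcK hd τ lam hτ hsize hlam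
  subst hS
  obtain ⟨hn, hm⟩ := GSM.pos_of_one_lt_multiplierBound (hδ.trans hδC)
  obtain ⟨hδ1, hδs⟩ := GSM.sub_one_le_of_lt_multiplierBound hδC hτ
  have H : GSM.BoundedWeights h M M' := ⟨hmem, hM, hM'⟩
  obtain ⟨E, hE, hPE, hEω⟩ := GSM.exists_event H hK hn hm hX hind hτ
  refine ⟨E, hE, hPE, fun ω hω => ?_⟩
  obtain ⟨hx, hdevΓ, hdevg⟩ := hEω ω hω
  rw [← hcX, ← hΓ] at hdevΓ
  rw [← hcX] at hdevg
  have hn' : (0 : ℝ) < n := by exact_mod_cast hn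
  have hlog : 0 ≤ Real.log m := Real.log_natCast_nonneg m
  set y := τ * Real.log m / n with hy
  have hy0 : 0 ≤ y := by positivity
  set s := √y + y with hs
  have hs0 : 0 ≤ s := by positivity
  let j₀ : Fin m := ⟨0, by omega⟩
  have hMpos := H.M_pos j₀
  have hM'0 := H.M'_nonneg j₀
  have hc0 : 0 < cX := hcX ▸ GSM.cX_pos hK j₀
  have hcΓ0 : 0 ≤ cΓ := hcΓ ▸ GSM.rowSumNorm_nonneg _
  have hcK0 : 0 ≤ cK := hcK ▸ GSM.rowSumNorm_nonneg _
  have hd0 : 0 ≤ d := hd ▸ Nat.cast_nonneg _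
  have h2α : 0 < 2 - α := by linarith
  have hG : ∀ p q, |Γ₀ p q| ≤ 64 * (M * cX ^ 2) := by
    intro p q
    rw [hΓ, hcX]
    refine ((H.subExp_gammaTerm hK p q).abs_integral_le).trans (le_of_eq ?_)
    ring
  have hε := GSM.abs_amplifiedGamma_sub_le hδ hδ1 hδs hs0 (by positivity) hG hdevΓ
  have hηα : cΓ * (3000 * (M * cX ^ 2) * s * d) ≤ α / 8 := by
    have h1 := GSM.sample_size_bound (B := M * cΓ * cX ^ 2 * d) (α := α) (y := y)
      (by positivity) hα hy0 (by
        have e1 : (M * cΓ * cX ^ 2 * d / α) ^ 2 = M ^ 2 * cΓ ^ 2 * cX ^ 4 * d ^ 2 / α ^ 2 := by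
          ring
        rw [e1, hy]
        have := (div_lt_one hn').2 hsize
        refine le_trans (le_of_eq ?_) this.le
        ring)
    refine le_trans (le_of_eq ?_) h1
    rw [hs]; ring
  set R := M * cK * cX ^ 2 + M' * cX + M with hR
  have hR0 : 0 ≤ R := by positivity
  -- The factor 2 - α in the bound on λ is at least 1 and is dropped.
  have hlam1 : 24000 * (R * s) ≤ lam * α := by
    have h1 : 24000 * ((2 - α) / α * R * s) * α = (2 - α) * (24000 * (R * s)) := by
      field_simp
    have h2 := mul_le_mul_of_nonneg_right hlam.le hα.le
    rw [h1] at h2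
    have h3 : 0 ≤ (1 - α) * (24000 * (R * s)) :=
      mul_nonneg (by linarith) (by positivity)
    linarith
  have hlam0 : 0 ≤ lam := le_trans (by positivity) hlam.le
  have hρα : 80 * (M' * cX + M) * s + 3000 * (M * cX ^ 2) * s * cK ≤ lam * (α / 8) := by
    have h1 : 0 ≤ M' * cX * s := by positivity
    have h2 : 0 ≤ M * s := by positivity
    rw [hR] at hlam1
    linarith
  subst hcΓ hcK hd
  obtain ⟨Khat, hmin, huniq, hsub, hb⟩ := GSM.estimator_of_bounds (lam := lam) hK hn hδ hx hα hα1
    hQ hirr (g₀ := fun p => ∫ x, GSM.gTerm h x p ∂(GSM.truncNormal 0 K₀))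
    (by rw [hΓ]; ext p; exact H.popGamma_mulVec hK p)
    (fun p q hpq => by rw [hΓ]; exact GSM.popGamma_eq_zero hpq) hlam0 hε (by positivity)
    hdevg (by positivity) hηα hρα
  set b := 2 * GSM.cGamma Γ₀ (GSM.supp K₀) / (2 - α) * lam with hbdef
  have hb0 : 0 ≤ b := by positivity
  have hsupp : ∀ p ∉ GSM.supp K₀, (Khat - K₀) p.1 p.2 = 0 := by
    intro p hp
    have h1 : K₀ p.1 p.2 = 0 := by simpa [GSM.supp] using hp
    have h2 : Khat p.1 p.2 = 0 := by simpa [GSM.supp] using fun h => hp (hsub h)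
    rw [Matrix.sub_apply, h1, h2, sub_zero]
  refine ⟨Khat, hmin, huniq, hsub, GSM.maxNorm_le hb0 hb, GSM.frobNorm_le hb0 hb hsupp,
    GSM.specNorm_le hK.isHermitian hb0 hb hsupp, fun hbig => ?_⟩
  have hsign : ∀ p ∈ GSM.supp K₀,
      SignType.sign (Khat p.1 p.2) = SignType.sign (K₀ p.1 p.2) := by
    intro p hp
    have h1 := hbig p hp
    have h2 := abs_le.1 (hb p)
    rw [Matrix.sub_apply] at h2
    rcases lt_trichotomy (K₀ p.1 p.2) 0 with h3 | h3 | h3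
    · rw [abs_of_neg h3] at h1
      rw [sign_neg h3, sign_neg (by linarith [h2.2])]
    · rw [h3, abs_zero] at h1
      linarith
    · rw [abs_of_pos h3] at h1
      rw [sign_pos h3, sign_pos (by linarith [h2.1])]
  refine ⟨Finset.Subset.antisymm hsub fun p hp => ?_, hsign⟩
  have h1 : K₀ p.1 p.2 ≠ 0 := by simpa [GSM.supp] using hp
  have h2 := hsign p hp
  simp only [GSM.supp, Finset.mem_filter, Finset.mem_univ, true_and]
  intro h0
  rw [h0, sign_zero] at h2
  exact h1 (sign_eq_zero_iff.1 h2.symm)
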